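/- Let $\alpha\in(0,1)$, $\lambda>0$, $m\ge 1$, let $\Delta_m=\{u\in\mathbb R_+^m:\sum_i u_i=1\}$, and let $Z$ be an $\mathbb R^m$-valued random vector with $\mathbb E\|Z\|^2<\infty$ whose law is absolutely continuous with respect to Lebesgue measure. Put $$p_\lambda(u,\theta)=-\sum_{i=1}^m u_i\,\mathbb E[Z_i]+\lambda\Big(\theta+\tfrac1{1-\alpha}\,\mathbb E\big[(\langle Z,u\rangle-\theta)^+\big]\Big),\qquad \min p_\lambda=\min_{\Delta_m\times\mathbb R}p_\lambda .$$ Let $(\hat Z^{k})_{k\ge1}$ be independent $\mathbb R^m$-valued random vectors and let $(\delta_k)_{k\ge1}$, $(\upsilon_k)_{k\ge1}$ be real sequences such that, for every $k\ge 0$, $\mathcal W_1(\mathcal L(\hat Z^{k+1}),\mathcal L(Z))\le\delta_{k+1}$ (Wasserstein-1 distance) and $$\Big|\mathbb E\big[\langle Z,u\rangle \mathbf 1_{\langle Z,u\rangle\ge\theta}\big]-\mathbb E\big[\langle \hat Z^{k+1},u\rangle \mathbf 1_{\langle \hat Z^{k+1},u\rangle\ge\theta}\big]\Big|\le\upsilon_{k+1}\qquad\text{for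 all }u\in\Delta_m,\ \theta\in\mathbb R.$$ Let $(\eta_k)_{k\ge0}$ be positive step sizes, let $X_0=(U_0,\theta_0)\in\Delta_m\times\mathbb R$ be deterministic with all coordinates of $U_0$ positive, and let $X_k=(U_k,\theta_k)$ be the iterates of the biased stochastic mirror descent $$U_{k+1,i}=\frac{U_{k,i}\,e^{-\eta_{k+1}\hat g_{k+1,1,i}}}{\sum_j U_{k,j}\,e^{-\eta_{k+1}\hat g_{k+1,1,j}}},\qquad \theta_{k+1}=\theta_k-\eta_{k+1}\hat g_{k+1,2},$$ where $\hat g_{k+1,1}=-\hat Z^{k+1}+\frac{\lambda}{1-\alpha}\hat Z^{k+1}\mathbf 1_{\langle\hat Z^{k+1},U_k\rangle\ge\theta_k}$ and $\hat g_{k+1,2}=\lambda\big(1-\frac1{1-\alpha}\mathbf 1_{\langle\hat Z^{k+1},U_k\rangle\ge\theta_k}\big)$. Assume $\sum_{k\ge0}\eta_{k+1}=+\infty$, $\sum_{k\ge0}\eta_{k+1}^2<+\infty$ and $\sum_{k\ge0}\eta_{k+1}(\sqrt{\delta_{k+1}}+\upsilon_{k+1})<+\infty$. Then $p_\lambda$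 attains its minimum over $\Delta_m\times\mathbb R$, it is differentiable at every point of $\Delta_m\times\mathbb R$, and: (i) Almost surely $\sum_{k\ge0}\eta_{k+1}\big(p_\lambda(X_k)-\min p_\lambda\big)<+\infty$. For every minimizer $x^\star=(u^\star,\theta^\star)$ of $p_\lambda$ and every $k$, $0\le p_\lambda(X_k)-\min p_\lambda\le\langle\nabla p_\lambda(X_k),X_k-x^\star\rangle$. Suppose moreover that the bias bound holds in vector form, $\big\|\mathbb E[Z\mathbf 1_{\langle Z,u\rangle\ge\theta}]-\mathbb E[\hat Z^{k+1}\mathbf 1_{\langle\hat Z^{k+1},u\rangle\ge\theta}]\big\|\le\upsilon_{k+1}$ for all $k\ge0$, $u\in\Delta_m$, $\theta\in\mathbb R$, and that either (a) the laws of $\langle Z,u\rangle$, $u\in\Delta_m$, have densities bounded by a common constant, or (b) $\theta^\star=0$ or no minimizer of $p_\lambda$ has $\theta=0$ (for instance, $x^\star$ is the unique minimizer). Then almost surely $$\sum_{k\ge0}\eta_{k+1}\big(p_\lambda(X_k)-\min p_\lambda\big)\le\sum_{k\ge0}\eta_{k+1}\langle\nabla p_\lambda(X_k),X_k-x^\star\rangle<+\infty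 .$$ (ii) Almost surely the Cesàro average $\bar X^\eta_k=\big(\sum_{i=0}^k\eta_i\big)^{-1}\sum_{i=0}^k\eta_iX_i$ converges, and $p_\lambda(\bar X^\eta_k)\to\min p_\lambda$. (iii) If moreover $\sum_{k\ge0}(\sqrt{\delta_{k+1}}+\upsilon_{k+1})<+\infty$, then almost surely $X_k$ converges to a minimizer of $p_\lambda$ over $\Delta_m\times\mathbb R$, and $p_\lambda(X_k)\to\min p_\lambda$. -/

import Mathlib

open MeasureTheory ProbabilityTheory Filter Topology
open scoped ENNReal NNReal

namespace BiasedSMD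

/-- Euclidean space `ℝ^m`, in which returns and portfolio weights live. -/
abbrev Vec (m : ℕ) : Type := EuclideanSpace ℝ (Fin m)

/-- The simplex `Δ_m`. -/
def simplex (m : ℕ) : Set (Vec m) := {u | (∀ i, 0 ≤ u i) ∧ ∑ i, u i = 1}

/-- The constraint set `Δ_m × ℝ` of the points `x = (u, θ)`. -/
def feasible (m : ℕ) : Set (Vec m × ℝ) := {x | x.1 ∈ simplex m}

/-- The Wasserstein-1 distance (Euclidean cost): infimum over all couplings. -/
noncomputable def wasserstein1 {m : ℕ} (μ ν : Measure (Vec m)) : ℝ≥0∞ :=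
  ⨅ π ∈ {π : Measure (Vec m × Vec m) | π.map Prod.fst = μ ∧ π.map Prod.snd = ν},
    ∫⁻ z, edist z.1 z.2 ∂π

/-- The indicator of `⟨z, u⟩ ≥ θ`, for `x = (u, θ)`. -/
noncomputable def ind {m : ℕ} (x : Vec m × ℝ) (z : Vec m) : ℝ :=
  Set.indicator {z : Vec m | x.2 ≤ inner ℝ z x.1} (fun _ => (1 : ℝ)) z

section Objective

variable {Ω : Type*} [MeasurableSpace Ω] {m : ℕ}

/-- `ψ_α(u, θ) = θ + (1 - α)⁻¹ E[(⟨Z, u⟩ - θ)⁺]`. -/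
noncomputable def psi (P : Measure Ω) (Z : Ω → Vec m) (α : ℝ) (x : Vec m × ℝ) : ℝ :=
  x.2 + 1 / (1 - α) * ∫ ω, max 0 (inner ℝ (Z ω) x.1 - x.2) ∂P

/-- The penalized criterion `p_λ(u, θ) = - ∑ u_i E[Z_i] + λ ψ_α(u, θ)`. -/
noncomputable def pLam (P : Measure Ω) (Z : Ω → Vec m) (α lam : ℝ) (x : Vec m × ℝ) : ℝ :=
  -(∑ i, x.1 i * ∫ ω, Z ω i ∂P) + lam * psi P Z α x

/-- `min p_λ` over `Δ_m × ℝ`. -/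
noncomputable def minP (P : Measure Ω) (Z : Ω → Vec m) (α lam : ℝ) : ℝ :=
  sInf (pLam P Z α lam '' feasible m)

/-- `x` minimizes `p_λ` over `Δ_m × ℝ`. -/
def IsMinimizer (P : Measure Ω) (Z : Ω → Vec m) (α lam : ℝ) (x : Vec m × ℝ) : Prop :=
  x ∈ feasible m ∧ IsMinOn (pLam P Z α lam) (feasible m) x

end Objective

section Algorithm

variable {m : ℕ}

/-- First component of the stochastic gradient:
`ĝ₁ = - z + λ / (1 - α) z 1_{⟨z, u⟩ ≥ θ}`. -/
noncomputable def gradU (α lam : ℝ) (z : Vec m) (x : Vec m × ℝ) : Vec m :=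
  -z + (lam / (1 - α) * ind x z) • z

/-- Second component of the stochastic gradient:
`ĝ₂ = λ (1 - 1_{⟨z, u⟩ ≥ θ} / (1 - α))`. -/
noncomputable def gradTheta (α lam : ℝ) (z : Vec m) (x : Vec m × ℝ) : ℝ :=
  lam * (1 - 1 / (1 - α) * ind x z)

/-- One mirror descent step with step size `η` and sample `z`: the entropic (multiplicative,
normalized) update of `u` and the gradient update of `θ`. -/
noncomputable def step (α lam η : ℝ) (z : Vec m) (x : Vec m × ℝ) : Vec m × ℝ :=
  (WithLp.toLp 2 fun i =>
      x.1 i * Real.exp (-η * gradU α lam z x i) /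
        ∑ j, |x.1 j * Real.exp (-η * gradU α lam z x j)|,
    x.2 - η * gradTheta α lam z x)

/-- The iterates: `X_0 = x₀`, and `X_{k+1}` is obtained from `X_k` with the step size `η_{k+1}`
and the sample `z_{k+1}`. -/
noncomputable def smd (α lam : ℝ) (η : ℕ → ℝ) (x₀ : Vec m × ℝ) (z : ℕ → Vec m) :
    ℕ → Vec m × ℝ
  | 0 => x₀
  | k + 1 => step α lam (η (k + 1)) (z (k + 1)) (smd α lam η x₀ z k)

/-- The weighted Cesàro average `(∑_{i ≤ k} η_i)⁻¹ ∑_{i ≤ k} η_i X_i`. -/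
noncomputable def cesaro (η : ℕ → ℝ) (X : ℕ → Vec m × ℝ) (k : ℕ) : Vec m × ℝ :=
  (∑ i ∈ Finset.range (k + 1), η i)⁻¹ • ∑ i ∈ Finset.range (k + 1), η i • X i

end Algorithm

end BiasedSMD

/-!
The iterates converge almost surely to a minimizer, under the assumptions common to all three parts;
the Cesàro averages and the values of the criterion follow.

*Lyapunov function.* For a minimizer `x⋆`, let `V_k` be the Bregman divergence `bregman x⋆ X_k`
of the mirror map: the relative entropy of `U_k` with respect to `u⋆`, plus `(θ⋆ - θ_k)² / 2`.
One step decreases it by `η ⟨ĝ, X_k - x⋆⟩` up to the remainder of a log-sum-exp expansion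
(`bregman_step_le`). That remainder is of order `min s (s²)` with `s = η ‖Ẑ‖`, so it is integrable
although `Ẑ` only has a first moment; a coupling of `Ẑ` with `Z` bounds its mean by `η² E‖Z‖² + η W`
up to constants, where `W` is the Wasserstein distance of the two laws (`integral_truncSq_le`).

*Bias.* The cost of one sample is convex, hence `E⟨ĝ, x - x⋆⟩` is at least the difference of the
criteria of `Ẑ` at `x` and `x⋆`, which differs from `p_λ(x) - min p_λ` by at most a multiple of `W`
because costs are Lipschitz in the sample. The two bias bounds give `W ≤ K (√δ + υ)`
(`wasserstein1_toReal_le`), so these errors are summable against the steps.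

*Probability.* As the samples are independent, the Robbins–Siegmund theorem, deduced from the
convergence of bounded below supermartingales (`robbins_siegmund`), shows that almost surely `V_k`
converges and `∑ η_{k+1} E[⟨ĝ_{k+1}, X_k - x⋆⟩ | ℱ_k]` is summable (`ae_bregman_tendsto`); the
summability of the optimality gaps follows.

*Convergence.* Up to a constant depending on `x`, the divergence `bregman x X_k` is affine in `x`,
so its convergence for finitely many minimizers implies that for all of them
(`exists_finite_bregman_tendsto`), and one null set serves all minimizers. As the steps have infinite
total length, the optimality gap tends to zero along a subsequence; a cluster point of the latter is
a minimizer at which the Lyapunov function tends to zero along a subsequence, hence along the whole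
sequence (`exists_tendsto_minimizer`).

*Gradients under the law of `Z`.* To replace the law of `Ẑ` by that of `Z` in the summability of
`⟨∇p_λ(X_k), X_k - x⋆⟩`, the only new term is `|θ_k - θ⋆|` times the difference of the
probabilities of the half-space `⟨z, U_k⟩ ≥ θ_k`. Bounded densities make that difference of order
`√δ` (`abs_integral_ind_sub_le_sqrt`). Otherwise `|θ_k|` times it is at most `W + υ`
(`abs_mul_abs_integral_ind_sub_le`), and when no minimizer has threshold `0` the optimality gap is
bounded below for `θ_k` near `0` (`summable_threshold_mul`).
-/

namespace BiasedSMD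

/-! ### Couplings and the Wasserstein distance -/

section

variable {m : ℕ} {μ ν : Measure (Vec m)}

/-- Couplings that nearly achieve the Wasserstein distance, when it is finite. -/
theorem exists_coupling (h : wasserstein1 μ ν ≠ ⊤) {ε : ℝ} (hε : 0 < ε) :
    ∃ π : Measure (Vec m × Vec m), π.map Prod.fst = μ ∧ π.map Prod.snd = ν ∧
      Integrable (fun z => ‖z.1 - z.2‖) π ∧
      ∫ z, ‖z.1 - z.2‖ ∂π ≤ (wasserstein1 μ ν).toReal + ε := by
  have hlt : wasserstein1 μ ν < wasserstein1 μ ν + ENNReal.ofReal ε :=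
    ENNReal.lt_add_right h (by simpa using hε)
  nth_rewrite 1 [wasserstein1] at hlt
  simp only [iInf_lt_iff] at hlt
  obtain ⟨π, ⟨h1, h2⟩, h3⟩ := hlt
  have hmeas : Measurable fun z : Vec m × Vec m => z.1 - z.2 := by fun_prop
  simp_rw [edist_eq_enorm_sub] at h3
  have hint : Integrable (fun z : Vec m × Vec m => z.1 - z.2) π :=
    ⟨hmeas.aestronglyMeasurable, h3.trans_le le_top⟩
  refine ⟨π, h1, h2, hint.norm, ?_⟩
  rw [integral_norm_eq_lintegral_enorm hmeas.aestronglyMeasurable,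
    ← ENNReal.toReal_ofReal hε.le, ← ENNReal.toReal_add h ENNReal.ofReal_ne_top]
  exact ENNReal.toReal_mono (ENNReal.add_ne_top.2 ⟨h, ENNReal.ofReal_ne_top⟩) h3.le

theorem integrable_comp_fst {π : Measure (Vec m × Vec m)} (h : π.map Prod.fst = μ)
    {f : Vec m → ℝ} (hf : Integrable f μ) : Integrable (fun z => f z.1) π := by
  subst h
  exact hf.comp_measurable measurable_fst

theorem integrable_comp_snd {π : Measure (Vec m × Vec m)} (h : π.map Prod.snd = ν)
    {f : Vec m → ℝ} (hf : Integrable f ν) : Integrable (fun z => f z.2) π := by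
  subst h
  exact hf.comp_measurable measurable_snd

theorem integral_comp_fst {π : Measure (Vec m × Vec m)} (h : π.map Prod.fst = μ)
    {f : Vec m → ℝ} (hf : Measurable f) : ∫ z, f z.1 ∂π = ∫ z, f z ∂μ := by
  subst h
  rw [integral_map measurable_fst.aemeasurable hf.aestronglyMeasurable]

theorem integral_comp_snd {π : Measure (Vec m × Vec m)} (h : π.map Prod.snd = ν)
    {f : Vec m → ℝ} (hf : Measurable f) : ∫ z, f z.2 ∂π = ∫ z, f z ∂ν := by
  subst h
  rw [integral_map measurable_snd.aemeasurable hf.aestronglyMeasurable]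

/-- A finite Wasserstein distance transfers first moments from one law to the other. -/
theorem integrable_norm_of_wasserstein1 (h : wasserstein1 μ ν ≠ ⊤)
    (hν : Integrable (fun z => ‖z‖) ν) : Integrable (fun z => ‖z‖) μ := by
  obtain ⟨π, h1, h2, h3, -⟩ := exists_coupling h one_pos
  have hπ : Integrable (fun z : Vec m × Vec m => ‖z.1‖) π := by
    refine (h3.add (integrable_comp_snd h2 hν)).mono' (by fun_prop) (ae_of_all _ fun z => ?_)
    simpa using norm_le_norm_sub_add z.1 z.2
  rw [← h1]
  exact (integrable_map_measure (by fun_prop) measurable_fst.aemeasurable).2 hπ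

/-- Transfer principle: if `f z` is at most `g z' + K ‖z - z'‖`, then the means of `f` and `g`
differ by at most `K` times the Wasserstein distance. -/
theorem integral_le_add_wasserstein1 (h : wasserstein1 μ ν ≠ ⊤) {f g : Vec m → ℝ} {K : ℝ}
    (hK : 0 ≤ K) (hfm : Measurable f) (hgm : Measurable g) (hf : Integrable f μ)
    (hg : Integrable g ν) (hfg : ∀ z z', f z ≤ g z' + K * ‖z - z'‖) :
    ∫ z, f z ∂μ ≤ ∫ z, g z ∂ν + K * (wasserstein1 μ ν).toReal := by
  have key : ∀ ε : ℝ, 0 < ε →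
      ∫ z, f z ∂μ ≤ ∫ z, g z ∂ν + K * (wasserstein1 μ ν).toReal + K * ε := by
    intro ε hε
    obtain ⟨π, h1, h2, h3, h4⟩ := exists_coupling h hε
    calc ∫ z, f z ∂μ = ∫ z, f z.1 ∂π := (integral_comp_fst h1 hfm).symm
      _ ≤ ∫ z, (g z.2 + K * ‖z.1 - z.2‖) ∂π :=
        integral_mono (integrable_comp_fst h1 hf)
          ((integrable_comp_snd h2 hg).add (h3.const_mul K)) fun z => hfg z.1 z.2
      _ = ∫ z, g z ∂ν + K * ∫ z, ‖z.1 - z.2‖ ∂π := by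
        rw [integral_add (integrable_comp_snd h2 hg) (h3.const_mul K), integral_const_mul,
          integral_comp_snd h2 hgm]
      _ ≤ _ := by nlinarith
  have hlim : Tendsto (fun ε : ℝ => ∫ z, g z ∂ν + K * (wasserstein1 μ ν).toReal + K * ε)
      (𝓝[>] 0) (𝓝 (∫ z, g z ∂ν + K * (wasserstein1 μ ν).toReal)) := by
    refine (Continuous.tendsto' (by fun_prop) _ _ (by simp)).mono_left nhdsWithin_le_nhds
  exact ge_of_tendsto hlim (eventually_nhdsWithin_of_forall fun ε hε => key ε hε)

/-- One half of the Kantorovich–Rubinstein duality. -/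
theorem abs_integral_sub_le_wasserstein1 (h : wasserstein1 μ ν ≠ ⊤) {f : Vec m → ℝ} {K : ℝ}
    (hK : 0 ≤ K) (hfm : Measurable f) (hfμ : Integrable f μ) (hfν : Integrable f ν)
    (hf : ∀ z z', |f z - f z'| ≤ K * ‖z - z'‖) :
    |∫ z, f z ∂μ - ∫ z, f z ∂ν| ≤ K * (wasserstein1 μ ν).toReal := by
  have h1 := integral_le_add_wasserstein1 h hK hfm hfm hfμ hfν
    fun z z' => by have := (abs_le.1 (hf z z')).2; linarith
  have h2 := integral_le_add_wasserstein1 h hK hfm.neg hfm.neg hfμ.neg hfν.neg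
    fun z z' => by have := (abs_le.1 (hf z z')).1; simp only [Pi.neg_apply]; linarith
  simp only [Pi.neg_apply, integral_neg] at h2
  rw [abs_le]; constructor <;> linarith

/-- The independent coupling bounds the Wasserstein distance by the first moments. -/
theorem wasserstein1_toReal_le_moments [IsProbabilityMeasure μ] [IsProbabilityMeasure ν]
    (hμ : Integrable (fun z => ‖z‖) μ) (hν : Integrable (fun z => ‖z‖) ν) :
    (wasserstein1 μ ν).toReal ≤ ∫ z, ‖z‖ ∂μ + ∫ z, ‖z‖ ∂ν := by
  have h1 : (μ.prod ν).map Prod.fst = μ := by simp [Measure.map_fst_prod]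
  have h2 : (μ.prod ν).map Prod.snd = ν := by simp [Measure.map_snd_prod]
  have i1 := integrable_comp_fst h1 hμ
  have i2 := integrable_comp_snd h2 hν
  have hmeas : Measurable fun z : Vec m × Vec m => z.1 - z.2 := by fun_prop
  have hint : Integrable (fun z : Vec m × Vec m => z.1 - z.2) (μ.prod ν) :=
    (i1.add i2).mono' hmeas.aestronglyMeasurable (ae_of_all _ fun z => norm_sub_le _ _)
  have hle : wasserstein1 μ ν ≤ ∫⁻ z, edist z.1 z.2 ∂(μ.prod ν) := iInf₂_le _ ⟨h1, h2⟩
  simp_rw [edist_eq_enorm_sub] at hle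
  calc (wasserstein1 μ ν).toReal ≤ (∫⁻ z, ‖z.1 - z.2‖ₑ ∂(μ.prod ν)).toReal :=
        ENNReal.toReal_mono hint.2.ne hle
    _ = ∫ z, ‖z.1 - z.2‖ ∂(μ.prod ν) :=
        (integral_norm_eq_lintegral_enorm hmeas.aestronglyMeasurable).symm
    _ ≤ ∫ z, (‖z.1‖ + ‖z.2‖) ∂(μ.prod ν) :=
        integral_mono hint.norm (i1.add i2) fun z => norm_sub_le _ _
    _ = _ := by
        rw [integral_add i1 i2, integral_comp_fst h1 (by fun_prop),
          integral_comp_snd h2 (by fun_prop)]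

/-- The truncated square, which has linear growth: with steps of size `s`, it bounds the
second-order error of an entropic step even when the sample has no second moment. -/
noncomputable def truncSq (s : ℝ) : ℝ := min s (s ^ 2)

theorem truncSq_nonneg {s : ℝ} (hs : 0 ≤ s) : 0 ≤ truncSq s := le_min hs (sq_nonneg s)

theorem truncSq_le {s a b : ℝ} (hs : 0 ≤ s) (hab : s ≤ a + b) (hb : 0 ≤ b) :
    truncSq s ≤ 4 * a ^ 2 + 2 * b := by
  rcases le_total a b with h | h
  · exact (min_le_left _ _).trans (by nlinarith [sq_nonneg a])
  · have h1 : s ^ 2 ≤ (2 * a) ^ 2 := pow_le_pow_left₀ hs (by linarith) 2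
    exact (min_le_right _ _).trans (by linarith)

/-- The mean of the truncated square of a step `c ‖z‖` under `μ`, when only a law `ν` close to `μ`
has a second moment: the discrepancy contributes linearly. -/
theorem integral_truncSq_le (h : wasserstein1 μ ν ≠ ⊤) (hν1 : Integrable (fun z => ‖z‖) ν)
    (hν2 : Integrable (fun z => ‖z‖ ^ 2) ν) {c : ℝ} (hc : 0 ≤ c) :
    Integrable (fun z => truncSq (c * ‖z‖)) μ ∧
      ∫ z, truncSq (c * ‖z‖) ∂μ ≤
        4 * c ^ 2 * ∫ z, ‖z‖ ^ 2 ∂ν + 2 * c * (wasserstein1 μ ν).toReal := by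
  have hm : Measurable fun z : Vec m => truncSq (c * ‖z‖) := by
    unfold truncSq; fun_prop
  have hi : Integrable (fun z => truncSq (c * ‖z‖)) μ := by
    refine ((integrable_norm_of_wasserstein1 h hν1).const_mul c).mono' hm.aestronglyMeasurable
      (ae_of_all _ fun z => ?_)
    rw [Real.norm_of_nonneg (truncSq_nonneg (by positivity))]
    exact min_le_left _ _
  refine ⟨hi, ?_⟩
  rw [← integral_const_mul]
  refine integral_le_add_wasserstein1 h (by positivity) hm (by fun_prop) hi
    (hν2.const_mul _) fun z z' => ?_
  have := truncSq_le (s := c * ‖z‖) (a := c * ‖z'‖) (b := c * ‖z - z'‖) (by positivity)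
    (by rw [← mul_add, add_comm]; gcongr; exact norm_le_norm_sub_add z z')
    (by positivity)
  linarith [mul_pow c ‖z'‖ 2]

end

/-! ### The criterion and its stochastic gradient -/

section

variable {m : ℕ} {α lam : ℝ}

/-- The cost of the sample `z` at `x`, whose mean is `p_λ(x)`. -/
noncomputable def crit (α lam : ℝ) (x : Vec m × ℝ) (z : Vec m) : ℝ :=
  -inner ℝ z x.1 + lam * (x.2 + 1 / (1 - α) * max 0 (inner ℝ z x.1 - x.2))

/-- The stochastic gradient at `x`, as a linear form on directions. -/
noncomputable def gradForm (α lam : ℝ) (x : Vec m × ℝ) (z : Vec m) : Vec m × ℝ →L[ℝ] ℝ :=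
  (innerSL ℝ (gradU α lam z x)).comp (ContinuousLinearMap.fst ℝ (Vec m) ℝ) +
    gradTheta α lam z x • ContinuousLinearMap.snd ℝ (Vec m) ℝ

theorem gradForm_apply (x v : Vec m × ℝ) (z : Vec m) :
    gradForm α lam x z v = inner ℝ (gradU α lam z x) v.1 + gradTheta α lam z x * v.2 := by
  simp [gradForm]

/-- The mean under `μ` of the stochastic gradient at `x`, paired with the direction `v`. -/
noncomputable def meanGrad (μ : Measure (Vec m)) (α lam : ℝ) (x v : Vec m × ℝ) : ℝ :=
  ∫ z, gradForm α lam x z v ∂μ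

/-- A common constant: `gradBound * ‖z‖` bounds the weight part of the stochastic gradient at the
sample `z`, and `gradBound` its threshold part. -/
noncomputable def gradBound (α lam : ℝ) : ℝ := 1 + lam / (1 - α)

theorem ind_eq_ite (x : Vec m × ℝ) (z : Vec m) :
    ind x z = if x.2 ≤ inner ℝ z x.1 then 1 else 0 := by
  simp [ind, Set.indicator_apply]

theorem ind_nonneg (x : Vec m × ℝ) (z : Vec m) : 0 ≤ ind x z := by
  rw [ind_eq_ite]; split_ifs <;> norm_num

theorem ind_le_one (x : Vec m × ℝ) (z : Vec m) : ind x z ≤ 1 := by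
  rw [ind_eq_ite]; split_ifs <;> norm_num

theorem measurable_ind : Measurable fun p : (Vec m × ℝ) × Vec m => ind p.1 p.2 := by
  simp_rw [ind_eq_ite]
  exact Measurable.ite (measurableSet_le (by fun_prop) (by fun_prop)) measurable_const
    measurable_const

theorem measurable_ind_left (x : Vec m × ℝ) : Measurable (ind x) :=
  measurable_ind.comp measurable_prodMk_left

theorem measurable_gradU :
    Measurable fun p : (Vec m × ℝ) × Vec m => gradU α lam p.2 p.1 := by
  have := measurable_ind (m := m)
  unfold gradU
  fun_prop

theorem measurable_gradTheta :
    Measurable fun p : (Vec m × ℝ) × Vec m => gradTheta α lam p.2 p.1 := by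
  have := measurable_ind (m := m)
  unfold gradTheta
  fun_prop

theorem measurable_gradForm (v : Vec m × ℝ → Vec m × ℝ) (hv : Measurable v) :
    Measurable fun p : (Vec m × ℝ) × Vec m => gradForm α lam p.1 p.2 (v p.1) := by
  simp_rw [gradForm_apply]
  have h1 := measurable_gradU (m := m) (α := α) (lam := lam)
  have h2 := measurable_gradTheta (m := m) (α := α) (lam := lam)
  fun_prop

theorem measurable_crit (x : Vec m × ℝ) : Measurable (crit α lam x) := by
  unfold crit; fun_prop

theorem norm_fst_le_one {x : Vec m × ℝ} (hx : x ∈ feasible m) : ‖x.1‖ ≤ 1 := by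
  have h : ‖x.1‖ ^ 2 ≤ 1 := by
    rw [EuclideanSpace.norm_sq_eq, ← hx.2]
    refine Finset.sum_le_sum fun i _ => ?_
    have h1 : x.1 i ≤ 1 := hx.2 ▸ Finset.single_le_sum (fun j _ => hx.1 j) (Finset.mem_univ i)
    rw [Real.norm_of_nonneg (hx.1 i)]
    nlinarith [hx.1 i]
  nlinarith [norm_nonneg x.1]

section Bounds

variable (hα : α ∈ Set.Ioo (0 : ℝ) 1) (hlam : 0 < lam)
include hα hlam

theorem lam_div_pos : 0 < lam / (1 - α) := div_pos hlam (by linarith [hα.2])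

theorem gradBound_pos : 0 < gradBound α lam := by
  have := lam_div_pos hα hlam
  unfold gradBound; positivity

theorem norm_gradU_le (x : Vec m × ℝ) (z : Vec m) :
    ‖gradU α lam z x‖ ≤ gradBound α lam * ‖z‖ := by
  have h := lam_div_pos hα hlam
  refine (norm_add_le _ _).trans ?_
  rw [norm_neg, norm_smul, gradBound, add_mul, one_mul, norm_mul,
    Real.norm_of_nonneg h.le, Real.norm_of_nonneg (ind_nonneg x z)]
  gcongr
  exact mul_le_of_le_one_right h.le (ind_le_one x z)

theorem abs_gradTheta_le (x : Vec m × ℝ) (z : Vec m) :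
    |gradTheta α lam z x| ≤ gradBound α lam := by
  have h1 : 1 ≤ 1 / (1 - α) := by
    rw [le_div_iff₀ (by linarith [hα.2])]; linarith [hα.1]
  have h2 : lam / (1 - α) = lam * (1 / (1 - α)) := by ring
  unfold gradTheta gradBound
  rw [h2, abs_mul, abs_of_pos hlam, ind_eq_ite]
  have h3 : lam * 1 ≤ lam * (1 / (1 - α)) := by gcongr
  split_ifs
  · rw [abs_of_nonpos (by linarith)]; linarith
  · simp only [mul_zero, sub_zero, abs_one]; linarith

/-- The subgradient inequality for the cost of one sample. -/
theorem crit_sub_le_gradForm (x y : Vec m × ℝ) (z : Vec m) :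
    crit α lam x z - crit α lam y z ≤ gradForm α lam x z (x - y) := by
  have h := lam_div_pos hα hlam
  have e1 : crit α lam x z = -inner ℝ z x.1 + lam * x.2 +
      lam / (1 - α) * max 0 (inner ℝ z x.1 - x.2) := by unfold crit; ring
  have e2 : crit α lam y z = -inner ℝ z y.1 + lam * y.2 +
      lam / (1 - α) * max 0 (inner ℝ z y.1 - y.2) := by unfold crit; ring
  have e3 : gradForm α lam x z (x - y) = -(inner ℝ z x.1 - inner ℝ z y.1) + lam * (x.2 - y.2) +
      lam / (1 - α) * (ind x z * ((inner ℝ z x.1 - x.2) - (inner ℝ z y.1 - y.2))) := by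
    rw [gradForm_apply]
    simp only [gradU, gradTheta, inner_add_left, inner_neg_left, real_inner_smul_left,
      Prod.fst_sub, Prod.snd_sub, inner_sub_right]
    ring
  have e4 : max 0 (inner ℝ z x.1 - x.2) - max 0 (inner ℝ z y.1 - y.2) ≤
      ind x z * ((inner ℝ z x.1 - x.2) - (inner ℝ z y.1 - y.2)) := by
    rw [ind_eq_ite]
    split_ifs with hc
    · rw [max_eq_right (by linarith : (0 : ℝ) ≤ inner ℝ z x.1 - x.2)]
      linarith [le_max_right 0 (inner ℝ z y.1 - y.2)]
    · rw [max_eq_left (by linarith : inner ℝ z x.1 - x.2 ≤ (0 : ℝ))]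
      linarith [le_max_left 0 (inner ℝ z y.1 - y.2)]
  rw [e1, e2, e3]
  nlinarith [mul_le_mul_of_nonneg_left e4 h.le]

theorem abs_crit_sub_le_sample {x : Vec m × ℝ} (hx : x ∈ feasible m) (z z' : Vec m) :
    |crit α lam x z - crit α lam x z'| ≤ gradBound α lam * ‖z - z'‖ := by
  have h := lam_div_pos hα hlam
  have h1 : |inner ℝ z x.1 - inner ℝ z' x.1| ≤ ‖z - z'‖ := by
    rw [← inner_sub_left]
    exact (abs_real_inner_le_norm _ _).trans
      (mul_le_of_le_one_right (norm_nonneg _) (norm_fst_le_one hx))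
  have h2 := abs_max_sub_max_le_abs (inner ℝ z x.1 - x.2) (inner ℝ z' x.1 - x.2) 0
  rw [max_comm, max_comm (inner ℝ z' x.1 - x.2), sub_sub_sub_cancel_right] at h2
  have e : crit α lam x z - crit α lam x z' = -(inner ℝ z x.1 - inner ℝ z' x.1) +
      lam / (1 - α) * (max 0 (inner ℝ z x.1 - x.2) - max 0 (inner ℝ z' x.1 - x.2)) := by
    unfold crit; ring
  rw [e, gradBound, add_mul, one_mul]
  refine (abs_add_le _ _).trans ?_
  rw [abs_neg, abs_mul, abs_of_pos h]
  gcongr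
  exact h2.trans h1

theorem abs_gradForm_le (x v : Vec m × ℝ) (z : Vec m) :
    |gradForm α lam x z v| ≤ gradBound α lam * (‖z‖ + 1) * ‖v‖ := by
  have hb := gradBound_pos hα hlam
  rw [gradForm_apply]
  calc _ ≤ |inner ℝ (gradU α lam z x) v.1| + |gradTheta α lam z x * v.2| := abs_add_le _ _
    _ ≤ (gradBound α lam * ‖z‖) * ‖v‖ + gradBound α lam * ‖v‖ := by
      rw [abs_mul]
      gcongr
      · refine (abs_real_inner_le_norm _ _).trans ?_
        gcongr
        · exact norm_gradU_le hα hlam x z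
        · exact norm_fst_le v
      · exact abs_gradTheta_le hα hlam x z
      · exact norm_snd_le v
    _ = _ := by ring

theorem abs_crit_sub_le (x y : Vec m × ℝ) (z : Vec m) :
    |crit α lam x z - crit α lam y z| ≤ gradBound α lam * (‖z‖ + 1) * ‖x - y‖ := by
  rw [abs_le]
  have h1 := crit_sub_le_gradForm hα hlam x y z
  have h2 := crit_sub_le_gradForm hα hlam y x z
  have h3 := (abs_le.1 (abs_gradForm_le hα hlam x (x - y) z)).2
  have h4 := (abs_le.1 (abs_gradForm_le hα hlam y (y - x) z)).2
  rw [norm_sub_rev] at h4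
  constructor <;> linarith

section Integrals

variable {μ : Measure (Vec m)} [IsProbabilityMeasure μ] (hμ : Integrable (fun z => ‖z‖) μ)
include hμ

theorem integrable_gradForm (x v : Vec m × ℝ) :
    Integrable (fun z => gradForm α lam x z v) μ := by
  have hm : Measurable fun z => gradForm α lam x z v := by
    have h1 := measurable_gradForm (α := α) (lam := lam) (fun _ : Vec m × ℝ => v) measurable_const
    have h2 : Measurable fun z : Vec m => (x, z) := by fun_prop
    have h3 := h1.comp h2
    exact h3
  have hb : Integrable (fun z => gradBound α lam * (‖z‖ + 1) * ‖v‖) μ :=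
    ((hμ.add (integrable_const 1)).const_mul (gradBound α lam)).mul_const ‖v‖
  refine hb.mono' hm.aestronglyMeasurable (ae_of_all _ fun z => ?_)
  rw [Real.norm_eq_abs]
  exact abs_gradForm_le hα hlam x v z

omit hα hlam [IsProbabilityMeasure μ] in
theorem integrable_inner (u : Vec m) : Integrable (fun z => inner ℝ z u) μ :=
  (hμ.mul_const ‖u‖).mono' (by fun_prop) (ae_of_all _ fun z => norm_inner_le_norm z u)

omit hα hlam in
theorem integrable_crit (x : Vec m × ℝ) : Integrable (crit α lam x) μ := by
  have h1 := integrable_inner hμ x.1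
  have h2 : Integrable (fun z => max 0 (inner ℝ z x.1 - x.2)) μ := by
    have := (h1.sub (integrable_const x.2)).pos_part
    simpa [max_comm] using this
  exact h1.neg.add (((integrable_const _).add (h2.const_mul _)).const_mul _)

/-- Convexity of `p_λ`, for any law of the sample. -/
theorem integral_crit_sub_le_meanGrad (x y : Vec m × ℝ) :
    ∫ z, crit α lam x z ∂μ - ∫ z, crit α lam y z ∂μ ≤ meanGrad μ α lam x (x - y) := by
  rw [← integral_sub (integrable_crit hμ x) (integrable_crit hμ y)]
  exact integral_mono ((integrable_crit hμ x).sub (integrable_crit hμ y))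
    (integrable_gradForm hα hlam hμ x _) fun z => crit_sub_le_gradForm hα hlam x y z

theorem abs_meanGrad_le (x v : Vec m × ℝ) :
    |meanGrad μ α lam x v| ≤ gradBound α lam * (∫ z, ‖z‖ ∂μ + 1) * ‖v‖ := by
  have h1 : Integrable (fun z => gradBound α lam * (‖z‖ + 1) * ‖v‖) μ :=
    ((hμ.add (integrable_const 1)).const_mul (gradBound α lam)).mul_const ‖v‖
  have h2 := norm_integral_le_of_norm_le h1 (f := fun z => gradForm α lam x z v)
    (ae_of_all _ fun z => by
      rw [Real.norm_eq_abs]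
      exact abs_gradForm_le hα hlam x v z)
  rw [← Real.norm_eq_abs]
  refine h2.trans_eq ?_
  rw [integral_mul_const, integral_const_mul, integral_add hμ (integrable_const 1)]
  simp

end Integrals

end Bounds

end

/-! ### Differentiability and minimizers -/

section

variable {m : ℕ} {α lam : ℝ}

/-- The criterion depends on `Z` only through its law. -/
theorem pLam_eq_integral_crit {Ω : Type*} [MeasurableSpace Ω] {P : Measure Ω}
    [IsProbabilityMeasure P] {Z : Ω → Vec m} (hZ : Measurable Z)
    (hμ : Integrable (fun z => ‖z‖) (P.map Z)) (x : Vec m × ℝ) :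
    pLam P Z α lam x = ∫ z, crit α lam x z ∂(P.map Z) := by
  have hi : Integrable (fun ω => ‖Z ω‖) P := hμ.comp_measurable hZ
  have hin : ∀ u : Vec m, Integrable (fun ω => inner ℝ (Z ω) u) P := fun u =>
    (integrable_inner hμ u).comp_measurable hZ
  have hco : ∀ i, Integrable (fun ω => Z ω i) P := fun i =>
    hi.mono' (by fun_prop) (ae_of_all _ fun ω => PiLp.norm_apply_le (Z ω) i)
  have hsum : ∑ i, x.1 i * ∫ ω, Z ω i ∂P = ∫ ω, inner ℝ (Z ω) x.1 ∂P := by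
    simp only [PiLp.inner_apply, RCLike.inner_apply, conj_trivial]
    rw [integral_finsetSum _ fun i _ => (hco i).const_mul _]
    simp_rw [integral_const_mul]
  have hmax : Integrable (fun ω => max 0 (inner ℝ (Z ω) x.1 - x.2)) P := by
    have := ((hin x.1).sub (integrable_const x.2)).pos_part
    simpa [max_comm] using this
  rw [integral_map hZ.aemeasurable (measurable_crit x).aestronglyMeasurable]
  unfold pLam psi crit
  have h1 : Integrable (fun ω => -inner ℝ (Z ω) x.1) P := (hin x.1).neg
  have h2 : Integrable (fun ω => 1 / (1 - α) * max 0 (inner ℝ (Z ω) x.1 - x.2)) P :=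
    hmax.const_mul _
  have h3 : Integrable (fun ω => x.2 + 1 / (1 - α) * max 0 (inner ℝ (Z ω) x.1 - x.2)) P :=
    (integrable_const _).add h2
  rw [hsum, integral_add h1 (h3.const_mul _), integral_neg, integral_const_mul,
    integral_add (integrable_const _) h2, integral_const_mul]
  simp

theorem fst_ne_zero {x : Vec m × ℝ} (hx : x ∈ feasible m) : x.1 ≠ 0 := by
  intro h
  have := hx.2
  simp [h] at this

theorem volume_hyperplane {u : Vec m} (hu : u ≠ 0) (θ : ℝ) :
    (volume : Measure (Vec m)) {z | inner ℝ z u = θ} = 0 := by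
  rcases Set.eq_empty_or_nonempty {z : Vec m | inner ℝ z u = θ} with h | ⟨z₀, hz₀⟩
  · rw [h, measure_empty]
  have hker : (volume : Measure (Vec m)) (LinearMap.ker (innerSL ℝ u).toLinearMap : Set (Vec m))
      = 0 := by
    refine Measure.addHaar_submodule _ _ fun htop => hu ?_
    have : u ∈ LinearMap.ker (innerSL ℝ u).toLinearMap := htop ▸ Submodule.mem_top
    simpa using this
  have hset : {z : Vec m | inner ℝ z u = θ} =
      (fun z => -z₀ + z) ⁻¹' (LinearMap.ker (innerSL ℝ u).toLinearMap : Set (Vec m)) := by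
    ext z
    have hz₁ : inner ℝ z₀ u = θ := hz₀
    have e1 : inner ℝ u (-z₀ + z) = inner ℝ z u - θ := by
      rw [inner_add_right, inner_neg_right, real_inner_comm, real_inner_comm z, hz₁]; ring
    show inner ℝ z u = θ ↔ inner ℝ u (-z₀ + z) = 0
    rw [e1, sub_eq_zero]
  rw [hset, measure_preimage_add, hker]

theorem hasFDerivAt_crit {x : Vec m × ℝ} {z : Vec m} (hz : inner ℝ z x.1 ≠ x.2) :
    HasFDerivAt (fun y => crit α lam y z) (gradForm α lam x z) x := by
  refine (gradForm α lam x z).hasFDerivAt.congr_of_eventuallyEq ?_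
  have hc : Continuous fun y : Vec m × ℝ => inner ℝ z y.1 - y.2 := by fun_prop
  rcases lt_or_gt_of_ne hz with h | h
  · filter_upwards [hc.continuousAt.eventually_lt continuousAt_const (sub_neg.2 h)] with y hy
    rw [crit, gradForm_apply, max_eq_left hy.le]
    simp only [gradU, gradTheta, ind_eq_ite, if_neg h.not_ge, inner_add_left, inner_neg_left,
      real_inner_smul_left]
    ring
  · filter_upwards [continuousAt_const.eventually_lt hc.continuousAt (sub_pos.2 h)] with y hy
    rw [crit, gradForm_apply, max_eq_right hy.le]
    simp only [gradU, gradTheta, ind_eq_ite, if_pos h.le, inner_add_left, inner_neg_left,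
      real_inner_smul_left]
    ring

theorem isCompact_simplex : IsCompact (simplex m) := by
  refine Metric.isCompact_of_isClosed_isBounded ?_ ?_
  · have h : simplex m = (⋂ i, {u : Vec m | 0 ≤ u i}) ∩ {u | ∑ i, u i = 1} := by
      ext u; simp [simplex]
    rw [h]
    exact (isClosed_iInter fun i => isClosed_le (by fun_prop) (by fun_prop)).inter
      (isClosed_eq (by fun_prop) (by fun_prop))
  · exact (Metric.isBounded_closedBall (x := (0 : Vec m)) (r := 1)).subset fun u hu => by
      simpa using norm_fst_le_one (x := (u, 0)) hu

theorem isCompact_feasible_slab (B : ℝ) :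
    IsCompact {x : Vec m × ℝ | x ∈ feasible m ∧ |x.2| ≤ B} := by
  have h : {x : Vec m × ℝ | x ∈ feasible m ∧ |x.2| ≤ B} = simplex m ×ˢ Set.Icc (-B) B := by
    ext x; simp [feasible, abs_le]
  rw [h]
  exact isCompact_simplex.prod isCompact_Icc

section

variable (hα : α ∈ Set.Ioo (0 : ℝ) 1) (hlam : 0 < lam)
  {μ : Measure (Vec m)} [IsProbabilityMeasure μ] (hμ : Integrable (fun z => ‖z‖) μ)
include hα hlam hμ

/-- Absolute continuity makes hyperplanes negligible, so that the kinks of the cost do not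
affect its mean. -/
theorem hasFDerivAt_integral_crit (hac : μ ≪ volume) {x : Vec m × ℝ} (hx : x ∈ feasible m) :
    Integrable (gradForm α lam x) μ ∧
      HasFDerivAt (fun y => ∫ z, crit α lam y z ∂μ) (∫ z, gradForm α lam x z ∂μ) x := by
  have hm1 : Measurable fun z => gradU α lam z x := by
    have := measurable_ind_left x
    unfold gradU; fun_prop
  have hm2 : Measurable fun z => gradTheta α lam z x := by
    have := measurable_ind_left x
    unfold gradTheta; fun_prop
  have hb : Integrable (fun z => gradBound α lam * (‖z‖ + 1)) μ :=
    (hμ.add (integrable_const 1)).const_mul (gradBound α lam)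
  refine hasFDerivAt_integral_of_dominated_loc_of_lip (s := Set.univ)
    (bound := fun z => gradBound α lam * (‖z‖ + 1)) univ_mem
    (Eventually.of_forall fun y => (measurable_crit y).aestronglyMeasurable)
    (integrable_crit hμ x) ?_ (ae_of_all _ fun z => ?_) hb ?_
  · have hc : Continuous fun p : Vec m × ℝ =>
        (innerSL ℝ p.1).comp (ContinuousLinearMap.fst ℝ (Vec m) ℝ) +
          p.2 • ContinuousLinearMap.snd ℝ (Vec m) ℝ := by fun_prop
    exact (hc.comp_stronglyMeasurable
      (hm1.stronglyMeasurable.prodMk hm2.stronglyMeasurable)).aestronglyMeasurable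
  · refine LipschitzOnWith.of_dist_le_mul fun y _ y' _ => ?_
    rw [Real.coe_nnabs, abs_of_nonneg (mul_nonneg (gradBound_pos hα hlam).le (by positivity)),
      Real.dist_eq, dist_eq_norm]
    exact abs_crit_sub_le hα hlam y y' z
  · have h0 : ∀ᵐ z ∂μ, inner ℝ z x.1 ≠ x.2 := by
      rw [ae_iff]
      simpa using hac (volume_hyperplane (fst_ne_zero hx) x.2)
    filter_upwards [h0] with z hz using hasFDerivAt_crit hz

/-- Coercivity of the criterion. -/
theorem coercive_integral_crit {x : Vec m × ℝ} (hx : x ∈ feasible m) :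
    lam * min 1 (α / (1 - α)) * |x.2| - gradBound α lam * ∫ z, ‖z‖ ∂μ ≤
      ∫ z, crit α lam x z ∂μ := by
  have h1α : 0 < 1 - α := by linarith [hα.2]
  have hpt : ∀ z, lam * min 1 (α / (1 - α)) * |x.2| - gradBound α lam * ‖z‖ ≤ crit α lam x z := by
    intro z
    have hin : |inner ℝ z x.1| ≤ ‖z‖ := (abs_real_inner_le_norm _ _).trans
      (mul_le_of_le_one_right (norm_nonneg _) (norm_fst_le_one hx))
    have hmono : crit α lam x z ≥ -‖z‖ + lam * x.2 := by
      unfold crit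
      have : 0 ≤ lam * (1 / (1 - α) * max 0 (inner ℝ z x.1 - x.2)) := by positivity
      nlinarith [(abs_le.1 hin).2]
    have hmono2 : crit α lam x z ≥ -gradBound α lam * ‖z‖ + lam * (α / (1 - α)) * (-x.2) := by
      unfold crit gradBound
      have e1 : lam * (α / (1 - α)) * (-x.2) = lam * x.2 - lam / (1 - α) * x.2 := by
        field_simp; ring
      have h2 : lam / (1 - α) * (-‖z‖ - x.2) ≤
          lam / (1 - α) * max 0 (inner ℝ z x.1 - x.2) := by
        have := (lam_div_pos hα hlam).le
        gcongr
        exact le_max_of_le_right (by linarith [(abs_le.1 hin).1])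
      have e2 : lam * (x.2 + 1 / (1 - α) * max 0 (inner ℝ z x.1 - x.2)) =
        lam * x.2 + lam / (1 - α) * max 0 (inner ℝ z x.1 - x.2) := by ring
      rw [e1, e2]
      nlinarith [(abs_le.1 hin).2]
    have hg : ‖z‖ ≤ gradBound α lam * ‖z‖ := by
      refine le_mul_of_one_le_left (norm_nonneg _) ?_
      unfold gradBound; linarith [lam_div_pos hα hlam]
    rcases le_total 0 x.2 with h | h
    · rw [abs_of_nonneg h]
      have : lam * min 1 (α / (1 - α)) * x.2 ≤ lam * x.2 := by
        gcongr; exact mul_le_of_le_one_right hlam.le (min_le_left _ _)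
      linarith
    · rw [abs_of_nonpos h]
      have : lam * min 1 (α / (1 - α)) * (-x.2) ≤ lam * (α / (1 - α)) * (-x.2) := by
        have := neg_nonneg.2 h
        gcongr; exact min_le_right _ _
      linarith
  have := integral_mono ((integrable_const _).sub (hμ.const_mul _)) (integrable_crit hμ x) hpt
  simp only [Pi.sub_apply] at this
  rw [integral_sub (integrable_const _) (hμ.const_mul _), integral_const_mul (gradBound α lam),
    integral_const] at this
  simpa only [probReal_univ, one_smul] using this

/-- A continuous coercive function on the constraint set attains its minimum. -/
theorem exists_isMinOn_integral_crit (hac : μ ≪ volume) (hne : (feasible m).Nonempty) :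
    ∃ x ∈ feasible m, IsMinOn (fun y => ∫ z, crit α lam y z ∂μ) (feasible m) x := by
  obtain ⟨x₀, hx₀⟩ := hne
  set p : Vec m × ℝ → ℝ := fun y => ∫ z, crit α lam y z ∂μ with hp
  have h1α : 0 < 1 - α := by linarith [hα.2]
  set c := lam * min 1 (α / (1 - α)) with hc
  have hcpos : 0 < c := mul_pos hlam (lt_min one_pos (div_pos hα.1 h1α))
  set D := gradBound α lam * ∫ z, ‖z‖ ∂μ with hD
  set B := max |x₀.2| ((p x₀ + D) / c) with hB
  have hcont : ContinuousOn p {x : Vec m × ℝ | x ∈ feasible m ∧ |x.2| ≤ B} := fun x hx =>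
    (hasFDerivAt_integral_crit hα hlam hμ hac hx.1).2.continuousAt.continuousWithinAt
  obtain ⟨xs, hxs, hmin⟩ := (isCompact_feasible_slab B).exists_isMinOn
    ⟨x₀, hx₀, le_max_left _ _⟩ hcont
  refine ⟨xs, hxs.1, fun x hx => ?_⟩
  by_cases h : |x.2| ≤ B
  · exact hmin ⟨hx, h⟩
  · have h1 : p xs ≤ p x₀ := hmin ⟨hx₀, le_max_left _ _⟩
    have h2 : c * |x.2| - D ≤ p x := coercive_integral_crit hα hlam hμ hx
    have h3 : (p x₀ + D) / c < |x.2| := (le_max_right _ _).trans_lt (not_le.1 h)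
    rw [div_lt_iff₀ hcpos] at h3
    show p xs ≤ p x
    linarith

end

end

/-! ### The Lyapunov function and one mirror descent step -/

section

variable {m : ℕ} {α lam : ℝ}

/-- The relative interior of the constraint set, in which the iterates stay. -/
def interiorFeasible (m : ℕ) : Set (Vec m × ℝ) := {x | x ∈ feasible m ∧ ∀ i, 0 < x.1 i}

/-- The Bregman divergence of the mirror map: relative entropy of the weights plus half the squared
distance of the thresholds. The convention `log 0 = 0` makes the terms with `x.1 i = 0` vanish. -/
noncomputable def bregman (x y : Vec m × ℝ) : ℝ :=
  ∑ i, (x.1 i * Real.log (x.1 i) - x.1 i * Real.log (y.1 i)) + (x.2 - y.2) ^ 2 / 2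

/-- The relative entropy dominates the squared Hellinger distance. -/
theorem hellinger_le_bregman {x y : Vec m × ℝ} (hx : x ∈ feasible m)
    (hy : y ∈ interiorFeasible m) :
    ∑ i, (√(x.1 i) - √(y.1 i)) ^ 2 + (x.2 - y.2) ^ 2 / 2 ≤ bregman x y := by
  have hterm : ∀ i, 2 * x.1 i - 2 * (√(x.1 i) * √(y.1 i)) ≤
      x.1 i * Real.log (x.1 i) - x.1 i * Real.log (y.1 i) := by
    intro i
    rcases (hx.1 i).eq_or_lt with h | h
    · simp [← h]
    · have hs : 0 < √(x.1 i) := Real.sqrt_pos.2 h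
      have ht : 0 < √(y.1 i) := Real.sqrt_pos.2 (hy.2 i)
      have h1 := Real.log_le_sub_one_of_pos (div_pos ht hs)
      rw [Real.log_div ht.ne' hs.ne', Real.log_sqrt h.le, Real.log_sqrt (hy.2 i).le] at h1
      have h2 : x.1 i * (√(y.1 i) / √(x.1 i)) = √(x.1 i) * √(y.1 i) := by
        nth_rewrite 1 [← Real.mul_self_sqrt h.le]; field_simp
      nlinarith
  have hsq : ∀ i, (√(x.1 i) - √(y.1 i)) ^ 2 =
      (2 * x.1 i - 2 * (√(x.1 i) * √(y.1 i))) + (y.1 i - x.1 i) := by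
    intro i
    have h1 := Real.sq_sqrt (hx.1 i)
    have h2 := Real.sq_sqrt (hy.2 i).le
    linear_combination h1 + h2
  have hsum : ∑ i, (√(x.1 i) - √(y.1 i)) ^ 2 =
      ∑ i, (2 * x.1 i - 2 * (√(x.1 i) * √(y.1 i))) := by
    simp_rw [hsq]
    rw [Finset.sum_add_distrib, Finset.sum_sub_distrib (f := fun i => y.1 i), hy.1.2, hx.2,
      sub_self, add_zero]
  rw [bregman, hsum]
  exact add_le_add_left (Finset.sum_le_sum fun i _ => hterm i) _

theorem bregman_nonneg {x y : Vec m × ℝ} (hx : x ∈ feasible m) (hy : y ∈ interiorFeasible m) :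
    0 ≤ bregman x y :=
  le_trans (add_nonneg (Finset.sum_nonneg fun _ _ => sq_nonneg _) (by positivity))
    (hellinger_le_bregman hx hy)

theorem sq_threshold_le_bregman {x y : Vec m × ℝ} (hx : x ∈ feasible m)
    (hy : y ∈ interiorFeasible m) : (x.2 - y.2) ^ 2 / 2 ≤ bregman x y :=
  (le_add_of_nonneg_left (Finset.sum_nonneg fun _ _ => sq_nonneg _)).trans
    (hellinger_le_bregman hx hy)

/-- The log-partition function is bounded by its linear part up to a remainder that is quadratic
for small exponents and linear for large ones. -/
theorem log_sum_exp_le {u y : Fin m → ℝ} (hu : ∀ i, 0 < u i) (hsum : ∑ i, u i = 1) {s : ℝ}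
    (hs : ∀ i, |y i| ≤ s) :
    Real.log (∑ i, u i * Real.exp (-y i)) ≤ -(∑ i, u i * y i) + 2 * truncSq s := by
  have hne : (Finset.univ : Finset (Fin m)).Nonempty := by
    rw [Finset.univ_nonempty_iff]
    by_contra h
    rw [not_nonempty_iff] at h
    simp at hsum
  have hpos : 0 < ∑ i, u i * Real.exp (-y i) :=
    Finset.sum_pos (fun i _ => mul_pos (hu i) (Real.exp_pos _)) hne
  have hs0 : 0 ≤ s := by obtain ⟨i, -⟩ := hne; exact (abs_nonneg _).trans (hs i)
  rw [truncSq]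
  rcases le_total s 1 with h | h
  · rw [min_eq_right (by nlinarith)]
    have hexp : ∀ i, Real.exp (-y i) ≤ 1 - y i + s ^ 2 := by
      intro i
      have hb : |-y i| ≤ 1 := by rw [abs_neg]; exact (hs i).trans h
      have h1 := (abs_le.1 (Real.abs_exp_sub_one_sub_id_le hb)).2
      have h2 : y i ^ 2 ≤ s ^ 2 := sq_le_sq' (by linarith [(abs_le.1 (hs i)).1])
        (abs_le.1 (hs i)).2
      nlinarith
    have hS : ∑ i, u i * Real.exp (-y i) ≤ 1 - ∑ i, u i * y i + s ^ 2 := by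
      calc _ ≤ ∑ i, u i * (1 - y i + s ^ 2) :=
            Finset.sum_le_sum fun i _ => mul_le_mul_of_nonneg_left (hexp i) (hu i).le
        _ = ∑ i, (u i - u i * y i + u i * s ^ 2) := by congr 1; ext i; ring
        _ = _ := by
          rw [Finset.sum_add_distrib, Finset.sum_sub_distrib, ← Finset.sum_mul, hsum, one_mul]
    have := Real.log_le_sub_one_of_pos hpos
    nlinarith [sq_nonneg s]
  · rw [min_eq_left (by nlinarith)]
    have hS : ∑ i, u i * Real.exp (-y i) ≤ Real.exp s := by
      calc _ ≤ ∑ i, u i * Real.exp s := Finset.sum_le_sum fun i _ =>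
            mul_le_mul_of_nonneg_left
              (Real.exp_le_exp.2 (by linarith [(abs_le.1 (hs i)).1])) (hu i).le
        _ = _ := by rw [← Finset.sum_mul, hsum, one_mul]
    have h1 : Real.log (∑ i, u i * Real.exp (-y i)) ≤ s := by
      rw [← Real.log_exp s]; exact Real.log_le_log hpos hS
    have h2 : ∑ i, u i * y i ≤ s := by
      calc _ ≤ ∑ i, u i * s := Finset.sum_le_sum fun i _ =>
            mul_le_mul_of_nonneg_left ((le_abs_self _).trans (hs i)) (hu i).le
        _ = _ := by rw [← Finset.sum_mul, hsum, one_mul]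
    linarith

theorem sum_abs_weights_pos {x : Vec m × ℝ} (hx : x ∈ interiorFeasible m) (g : Fin m → ℝ) :
    (∑ j, |x.1 j * Real.exp (g j)|) = ∑ j, x.1 j * Real.exp (g j) ∧
      0 < ∑ j, x.1 j * Real.exp (g j) := by
  constructor
  · exact Finset.sum_congr rfl fun j _ => abs_of_pos (mul_pos (hx.2 j) (Real.exp_pos _))
  · refine Finset.sum_pos (fun i _ => mul_pos (hx.2 i) (Real.exp_pos _)) ?_
    rw [Finset.univ_nonempty_iff]
    by_contra h
    rw [not_nonempty_iff] at h
    have := hx.1.2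
    simp at this

theorem step_mem_interiorFeasible {x : Vec m × ℝ} (hx : x ∈ interiorFeasible m) (η : ℝ)
    (z : Vec m) : step α lam η z x ∈ interiorFeasible m := by
  obtain ⟨h1, h2⟩ := sum_abs_weights_pos hx fun j => -η * gradU α lam z x j
  have hpos : ∀ i, 0 < (step α lam η z x).1 i := fun i => by
    simp only [step, h1]
    exact div_pos (mul_pos (hx.2 i) (Real.exp_pos _)) h2
  refine ⟨⟨fun i => (hpos i).le, ?_⟩, hpos⟩
  simp only [step, h1]
  rw [← Finset.sum_div, div_self h2.ne']

/-- Decrease of the Lyapunov function along one step, for a deterministic sample `z`. -/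
theorem bregman_step_le (hα : α ∈ Set.Ioo (0 : ℝ) 1) (hlam : 0 < lam) {x y : Vec m × ℝ}
    (hx : x ∈ feasible m) (hy : y ∈ interiorFeasible m) {η : ℝ} (hη : 0 ≤ η) (z : Vec m) :
    bregman x (step α lam η z y) ≤ bregman x y - η * gradForm α lam y z (y - x) +
      (2 * truncSq (η * gradBound α lam * ‖z‖) + (η * gradBound α lam) ^ 2) := by
  set g := gradU α lam z y with hg
  obtain ⟨h1, h2⟩ := sum_abs_weights_pos hy fun j => -η * g j
  set S := ∑ j, y.1 j * Real.exp (-η * g j) with hS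
  have hlog : ∀ i, Real.log ((step α lam η z y).1 i) = Real.log (y.1 i) - η * g i - Real.log S := by
    intro i
    simp only [step, ← hg, h1]
    rw [Real.log_div (mul_pos (hy.2 i) (Real.exp_pos _)).ne' h2.ne',
      Real.log_mul (hy.2 i).ne' (Real.exp_pos _).ne', Real.log_exp]
    ring
  have hin : ∀ u : Vec m, inner ℝ g u = ∑ i, u i * g i := fun u => by
    simp [PiLp.inner_apply]
  have hKL : ∑ i, (x.1 i * Real.log (x.1 i) - x.1 i * Real.log ((step α lam η z y).1 i)) =
      ∑ i, (x.1 i * Real.log (x.1 i) - x.1 i * Real.log (y.1 i)) + η * inner ℝ g x.1 +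
        Real.log S := by
    have e : ∀ i, x.1 i * Real.log (x.1 i) - x.1 i * Real.log ((step α lam η z y).1 i) =
        (x.1 i * Real.log (x.1 i) - x.1 i * Real.log (y.1 i)) + η * (x.1 i * g i) +
          x.1 i * Real.log S := fun i => by rw [hlog]; ring
    simp_rw [e]
    rw [Finset.sum_add_distrib, Finset.sum_add_distrib, ← Finset.mul_sum, ← Finset.sum_mul, hx.2,
      one_mul, hin]
  have hlogS : Real.log S ≤ -(η * inner ℝ g y.1) + 2 * truncSq (η * gradBound α lam * ‖z‖) := by
    have := log_sum_exp_le (u := fun i => y.1 i) (y := fun i => η * g i) hy.2 hy.1.2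
      (s := η * gradBound α lam * ‖z‖) fun i => by
        rw [abs_mul, abs_of_nonneg hη, mul_assoc]
        gcongr
        exact (PiLp.norm_apply_le g i).trans (norm_gradU_le hα hlam y z)
    rw [hin, Finset.mul_sum, hS]
    simpa only [neg_mul, mul_left_comm] using this
  have hθ : (x.2 - (step α lam η z y).2) ^ 2 / 2 ≤
      (x.2 - y.2) ^ 2 / 2 - η * (gradTheta α lam z y * (y.2 - x.2)) +
        (η * gradBound α lam) ^ 2 := by
    have h3 : (η * gradTheta α lam z y) ^ 2 ≤ (η * gradBound α lam) ^ 2 := by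
      rw [mul_pow, mul_pow]
      have := sq_le_sq.2 ((abs_gradTheta_le hα hlam y z).trans (le_abs_self _))
      gcongr
    simp only [step]
    nlinarith [sq_nonneg (η * gradTheta α lam z y)]
  have e : gradForm α lam y z (y - x) = inner ℝ g y.1 - inner ℝ g x.1 +
      gradTheta α lam z y * (y.2 - x.2) := by
    rw [gradForm_apply, Prod.fst_sub, Prod.snd_sub, inner_sub_right]
  rw [bregman, hKL, bregman, e]
  linarith

end

/-! ### Convergence of a sequence whose divergences to all minimizers converge -/

section

variable {m : ℕ}

/-- Convergence of `bregman x (y k)` for finitely many `x ∈ S` implies it for all `x ∈ S`: up to a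
constant depending on `x`, it is an affine function of `x`. -/
theorem exists_finite_bregman_tendsto (S : Set (Vec m × ℝ)) :
    ∃ b ⊆ S, b.Finite ∧ ∀ y : ℕ → Vec m × ℝ,
      (∀ x ∈ b, ∃ l, Tendsto (fun k => bregman x (y k)) atTop (𝓝 l)) →
      ∀ x ∈ S, ∃ l, Tendsto (fun k => bregman x (y k)) atTop (𝓝 l) := by
  set ι : Vec m × ℝ → (Vec m × ℝ) × ℝ := fun x => (x, 1) with hι
  have hinj : Function.Injective ι := fun x x' h => congrArg Prod.fst h
  obtain ⟨b, hbs, hspan, hli⟩ := exists_linearIndependent ℝ (ι '' S)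
  refine ⟨S ∩ ι ⁻¹' b, Set.inter_subset_left,
    (hli.setFinite.preimage hinj.injOn).subset Set.inter_subset_right, fun y hy x hx => ?_⟩
  -- the part of the divergence that depends on `k`, homogenized
  set ℓ : ℕ → (Vec m × ℝ) × ℝ → ℝ := fun k v =>
    -(∑ i, v.1.1 i * Real.log ((y k).1 i)) - v.1.2 * (y k).2 + v.2 * ((y k).2 ^ 2 / 2) with hℓ
  set c : Vec m × ℝ → ℝ := fun x => ∑ i, x.1 i * Real.log (x.1 i) + x.2 ^ 2 / 2 with hc
  have hdec : ∀ x k, bregman x (y k) = ℓ k (ι x) + c x := by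
    intro x k
    simp only [bregman, hℓ, hι, hc, Finset.sum_sub_distrib]
    ring
  have hmem : ι x ∈ Submodule.span ℝ b := hspan ▸ Submodule.subset_span ⟨x, hx, rfl⟩
  have hlim : ∀ v ∈ Submodule.span ℝ b, ∃ l, Tendsto (fun k => ℓ k v) atTop (𝓝 l) := by
    intro v hv
    induction hv using Submodule.span_induction with
    | mem v hv =>
      obtain ⟨x', hx', rfl⟩ := hbs hv
      obtain ⟨l, hl⟩ := hy x' ⟨hx', hv⟩
      exact ⟨l - c x', (hl.sub_const (c x')).congr fun k => by rw [hdec]; ring⟩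
    | zero => exact ⟨0, tendsto_const_nhds.congr fun k => by simp [hℓ]⟩
    | add v w _ _ hv hw =>
      obtain ⟨l, hl⟩ := hv
      obtain ⟨l', hl'⟩ := hw
      refine ⟨l + l', (hl.add hl').congr fun k => ?_⟩
      simp only [hℓ, Prod.fst_add, Prod.snd_add, PiLp.add_apply, add_mul, Finset.sum_add_distrib]
      ring
    | smul a v _ hv =>
      obtain ⟨l, hl⟩ := hv
      refine ⟨a * l, (hl.const_mul a).congr fun k => ?_⟩
      simp only [hℓ, Prod.smul_fst, Prod.smul_snd, PiLp.smul_apply, smul_eq_mul, mul_assoc,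
        ← Finset.mul_sum]
      ring
  obtain ⟨l, hl⟩ := hlim _ hmem
  exact ⟨l + c x, (hl.add_const (c x)).congr fun k => (hdec x k).symm⟩

theorem continuousAt_bregman_self (x : Vec m × ℝ) : ContinuousAt (bregman x) x := by
  have h : ∀ i, ContinuousAt (fun y : Vec m × ℝ => x.1 i * Real.log (y.1 i)) x := by
    intro i
    by_cases hi : x.1 i = 0
    · simp only [hi, zero_mul]; exact continuousAt_const
    · have : ContinuousAt (fun y : Vec m × ℝ => y.1 i) x := by fun_prop
      exact continuousAt_const.mul (this.log hi)
  unfold bregman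
  refine ContinuousAt.add (tendsto_finsetSum _ fun i _ => continuousAt_const.sub (h i)) ?_
  fun_prop

theorem bregman_self (x : Vec m × ℝ) : bregman x x = 0 := by simp [bregman]

/-- Convergence in Bregman divergence implies convergence. -/
theorem tendsto_of_bregman_tendsto_zero {x : Vec m × ℝ} (hx : x ∈ feasible m)
    {y : ℕ → Vec m × ℝ} (hy : ∀ k, y k ∈ interiorFeasible m)
    (h : Tendsto (fun k => bregman x (y k)) atTop (𝓝 0)) : Tendsto y atTop (𝓝 x) := by
  have h1 : Tendsto (fun k => (y k).2) atTop (𝓝 x.2) := by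
    have h0 : Tendsto (fun k => (x.2 - (y k).2) ^ 2) atTop (𝓝 0) := by
      refine squeeze_zero (fun k => sq_nonneg _) (fun k => ?_) (by simpa using h.const_mul 2)
      linarith [sq_threshold_le_bregman hx (hy k)]
    have h2 : Tendsto (fun k => x.2 - (y k).2) atTop (𝓝 0) := by
      rw [tendsto_zero_iff_abs_tendsto_zero]
      simpa [Real.sqrt_sq_eq_abs, Function.comp_def] using h0.sqrt
    simpa using h2.const_sub x.2
  have h3 : ∀ i, Tendsto (fun k => (y k).1 i) atTop (𝓝 (x.1 i)) := by
    intro i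
    have h0 : Tendsto (fun k => (√(x.1 i) - √((y k).1 i)) ^ 2) atTop (𝓝 0) := by
      refine squeeze_zero (fun k => sq_nonneg _) (fun k => ?_) h
      refine le_trans ?_ (hellinger_le_bregman hx (hy k))
      refine le_add_of_le_of_nonneg ?_ (by positivity)
      exact Finset.single_le_sum (f := fun i => (√(x.1 i) - √((y k).1 i)) ^ 2)
        (fun j _ => sq_nonneg _) (Finset.mem_univ i)
    have h2 : Tendsto (fun k => √(x.1 i) - √((y k).1 i)) atTop (𝓝 0) := by
      rw [tendsto_zero_iff_abs_tendsto_zero]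
      simpa [Real.sqrt_sq_eq_abs, Function.comp_def] using h0.sqrt
    have h4 := ((h2.const_sub (√(x.1 i))).pow 2)
    simpa [Real.sq_sqrt (hx.1 i), fun k => Real.sq_sqrt ((hy k).2 i).le] using h4
  have h5 : Tendsto (fun k => (y k).1) atTop (𝓝 x.1) :=
    ((PiLp.continuous_toLp 2 fun _ : Fin m => ℝ).tendsto (fun i => x.1 i)).comp
      (tendsto_pi_nhds.2 h3)
  exact h5.prodMk_nhds h1

/-- Summability of `η_k (p(X_k) - min p)` with steps of infinite total length makes some minimizer a
cluster point of the iterates; the Lyapunov function at that minimizer then tends to zero. -/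
theorem exists_tendsto_minimizer {p : Vec m × ℝ → ℝ} {pmin : ℝ}
    (hp : ∀ x ∈ feasible m, ContinuousAt p x) (hmin : ∀ x ∈ feasible m, pmin ≤ p x)
    (hne : ∃ x ∈ feasible m, p x = pmin) {η : ℕ → ℝ} (hη : ∀ k, 0 < η k)
    (hη1 : Tendsto (fun n => ∑ k ∈ Finset.range n, η (k + 1)) atTop atTop)
    {y : ℕ → Vec m × ℝ} (hy : ∀ k, y k ∈ interiorFeasible m)
    (hsum : Summable fun k => η (k + 1) * (p (y k) - pmin))
    (hV : ∀ x ∈ feasible m, p x = pmin →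
      ∃ l, Tendsto (fun k => bregman x (y k)) atTop (𝓝 l)) :
    ∃ x ∈ feasible m, p x = pmin ∧ Tendsto y atTop (𝓝 x) := by
  obtain ⟨xs, hxs, hps⟩ := hne
  -- the Lyapunov function at one minimizer bounds the thresholds
  obtain ⟨B, hB⟩ : ∃ B, ∀ k, |(y k).2| ≤ B := by
    obtain ⟨l, hl⟩ := hV xs hxs hps
    obtain ⟨B, hB⟩ := hl.bddAbove_range
    refine ⟨|xs.2| + (2 * B + 1), fun k => ?_⟩
    have h1 := (sq_threshold_le_bregman hxs (hy k)).trans (hB ⟨k, rfl⟩)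
    have h2 : |xs.2 - (y k).2| ≤ 2 * B + 1 := by
      nlinarith [sq_abs (xs.2 - (y k).2), sq_nonneg (|xs.2 - (y k).2| - 1)]
    have h3 := abs_sub_abs_le_abs_sub (y k).2 xs.2
    rw [abs_sub_comm] at h3
    linarith
  have hfreq : ∀ n : ℕ, ∃ k ≥ n, p (y k) - pmin ≤ 1 / ((n : ℝ) + 1) := by
    intro n
    by_contra! hcon
    have hs : Summable fun k => η (k + 1) := by
      refine Summable.of_norm_bounded_eventually_nat (hsum.mul_left ((n : ℝ) + 1)) ?_
      filter_upwards [eventually_ge_atTop n] with k hk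
      rw [Real.norm_of_nonneg (hη _).le]
      have h1 := hcon k hk
      rw [div_lt_iff₀ (by positivity)] at h1
      nlinarith [hη (k + 1)]
    exact not_tendsto_nhds_of_tendsto_atTop hη1 _ hs.hasSum.tendsto_sum_nat
  choose φ hφ hgap using hfreq
  have hφt : Tendsto φ atTop atTop := tendsto_atTop_mono hφ tendsto_id
  obtain ⟨x, ⟨hx, -⟩, ψ, hψ, hlim⟩ := (isCompact_feasible_slab (m := m) B).tendsto_subseq
    (x := fun n => y (φ n)) fun n => ⟨(hy _).1, hB _⟩
  have hpx : p x = pmin := by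
    have h1 : Tendsto (fun n => p (y (φ (ψ n)))) atTop (𝓝 (p x)) := (hp x hx).tendsto.comp hlim
    have h2 : Tendsto (fun n => p (y (φ (ψ n)))) atTop (𝓝 pmin) := by
      have h3 : Tendsto (fun n => pmin + 1 / ((ψ n : ℝ) + 1)) atTop (𝓝 pmin) := by
        simpa using (tendsto_one_div_add_atTop_nhds_zero_nat.comp hψ.tendsto_atTop).const_add pmin
      refine tendsto_of_tendsto_of_tendsto_of_le_of_le tendsto_const_nhds h3
        (fun n => hmin _ (hy _).1) fun n => ?_
      have := hgap (ψ n)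
      simp only
      linarith
    exact tendsto_nhds_unique h1 h2
  obtain ⟨l, hl⟩ := hV x hx hpx
  have hl0 : l = 0 := by
    have h1 := hl.comp (hφt.comp hψ.tendsto_atTop)
    have h2 : Tendsto (fun n => bregman x (y (φ (ψ n)))) atTop (𝓝 0) := by
      have := (continuousAt_bregman_self x).tendsto.comp hlim
      rwa [bregman_self] at this
    exact tendsto_nhds_unique h1 h2
  exact ⟨x, hx, hpx, tendsto_of_bregman_tendsto_zero hx hy (hl0 ▸ hl)⟩

/-- Weighted Cesàro averages of a convergent sequence have the same limit. -/
theorem tendsto_cesaro {η : ℕ → ℝ} (hη : ∀ k, 0 < η k)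
    (hη1 : Tendsto (fun n => ∑ k ∈ Finset.range n, η (k + 1)) atTop atTop)
    {y : ℕ → Vec m × ℝ} {x : Vec m × ℝ} (hy : Tendsto y atTop (𝓝 x)) :
    Tendsto (cesaro η y) atTop (𝓝 x) := by
  have hS : Tendsto (fun n => ∑ k ∈ Finset.range n, η k) atTop atTop := by
    rw [← tendsto_add_atTop_iff_nat 1]
    simp_rw [Finset.sum_range_succ']
    exact tendsto_atTop_add_const_right _ _ hη1
  have h1 : (fun k => η k • (y k - x)) =o[atTop] η := by
    have : (fun k => y k - x) =o[atTop] fun _ => (1 : ℝ) := by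
      rw [Asymptotics.isLittleO_one_iff]
      simpa using hy.sub_const x
    simpa using (Asymptotics.isBigO_refl η atTop).smul_isLittleO this
  have h2 := (h1.sum_range (fun k => (hη k).le) hS).tendsto_inv_smul_nhds_zero
  have h3 := (((tendsto_add_atTop_iff_nat 1).2 h2).add_const x)
  rw [zero_add] at h3
  refine h3.congr fun k => ?_
  have hpos : 0 < ∑ i ∈ Finset.range (k + 1), η i :=
    Finset.sum_pos (fun i _ => hη i) (by simp)
  rw [cesaro]
  simp_rw [smul_sub]
  rw [Finset.sum_sub_distrib, ← Finset.sum_smul, smul_sub, inv_smul_smul₀ hpos.ne', sub_add_cancel]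

end

/-! ### The Robbins–Siegmund argument -/

/-- The Robbins–Siegmund theorem with deterministic errors `r k`. The conditional inequality
`E[V_{k+1} | ℱ_k] ≤ V_k - β_k + r_k` is stated through integrals over the events of `ℱ_k`. -/
theorem robbins_siegmund {Ω : Type*} {mΩ : MeasurableSpace Ω} {P : Measure Ω} [IsFiniteMeasure P]
    {ℱ : Filtration ℕ mΩ} {V β : ℕ → Ω → ℝ} {r : ℕ → ℝ}
    (hVm : ∀ k, StronglyMeasurable[ℱ k] (V k)) (hβm : ∀ k, StronglyMeasurable[ℱ k] (β k))
    (hVi : ∀ k, Integrable (V k) P) (hβi : ∀ k, Integrable (β k) P)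
    (hV0 : ∀ k ω, 0 ≤ V k ω) (hβ0 : ∀ k ω, 0 ≤ β k ω) (hr0 : ∀ k, 0 ≤ r k) (hr : Summable r)
    (hstep : ∀ k s, MeasurableSet[ℱ k] s →
      ∫ ω in s, V (k + 1) ω ∂P ≤ ∫ ω in s, (V k ω - β k ω + r k) ∂P) :
    ∀ᵐ ω ∂P, (∃ l, Tendsto (fun k => V k ω) atTop (𝓝 l)) ∧ Summable fun k => β k ω := by
  -- minus the Lyapunov function, plus the accumulated decrease, plus the errors still to come
  set Y : ℕ → Ω → ℝ := fun k ω =>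
    -(V k ω + ∑ j ∈ Finset.range k, β j ω + (∑' j, r j - ∑ j ∈ Finset.range k, r j)) with hY
  have hYi : ∀ k, Integrable (Y k) P := fun k =>
    (((hVi k).add (integrable_finsetSum _ fun j _ => hβi j)).add (integrable_const _)).neg
  have hYm : ∀ k, StronglyMeasurable[ℱ k] (Y k) := fun k =>
    (((hVm k).add (Finset.stronglyMeasurable_fun_sum _ fun j hj =>
      (hβm j).mono (ℱ.mono (Finset.mem_range.1 hj).le))).add stronglyMeasurable_const).neg
  have hY0 : ∀ k ω, Y k ω ≤ 0 := by
    intro k ω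
    have h1 := hr.sum_le_tsum (Finset.range k) fun j _ => hr0 j
    have h2 := Finset.sum_nonneg fun j (_ : j ∈ Finset.range k) => hβ0 j ω
    have h3 := hV0 k ω
    simp only [hY]; linarith
  have hsub : Submartingale Y ℱ P := by
    refine submartingale_of_setIntegral_le_succ hYm hYi fun k s hs => ?_
    have hs' := ℱ.le k s hs
    have h1 := hstep k s hs
    have i1 : IntegrableOn (fun ω => V k ω - β k ω + r k) s P :=
      (((hVi k).sub (hβi k)).add (integrable_const _)).integrableOn
    have e : ∀ ω, Y (k + 1) ω - Y k ω = (V k ω - β k ω + r k) - V (k + 1) ω := by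
      intro ω
      simp only [hY, Finset.sum_range_succ]
      ring
    have h2 : 0 ≤ ∫ ω in s, (Y (k + 1) ω - Y k ω) ∂P := by
      simp_rw [e]
      rw [integral_sub i1 (hVi (k + 1)).integrableOn]
      linarith
    rw [integral_sub (hYi _).integrableOn (hYi _).integrableOn] at h2
    linarith
  have hbdd : ∀ n, eLpNorm (Y n) 1 P ≤ (∫ ω, -Y 0 ω ∂P).toNNReal := by
    intro n
    rw [eLpNorm_one_eq_lintegral_enorm, ← ofReal_integral_norm_eq_lintegral_enorm (hYi n)]
    refine ENNReal.ofReal_le_ofReal ?_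
    have h1 : ∫ ω, ‖Y n ω‖ ∂P = ∫ ω, -Y n ω ∂P :=
      integral_congr_ae (ae_of_all _ fun ω => by simp [abs_of_nonpos (hY0 n ω)])
    have h2 := hsub.setIntegral_le (Nat.zero_le n) MeasurableSet.univ
    rw [setIntegral_univ, setIntegral_univ] at h2
    have h3 : ∀ k, ∫ ω, -Y k ω ∂P = -∫ ω, Y k ω ∂P := fun k => integral_neg _
    rw [h1, h3, h3]
    linarith
  filter_upwards [hsub.ae_tendsto_limitProcess hbdd] with ω hlim
  obtain ⟨l, hω⟩ : ∃ l, Tendsto (fun n => Y n ω) atTop (𝓝 l) := ⟨_, hlim⟩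
  have hsumβ : Tendsto (fun k => V k ω + ∑ j ∈ Finset.range k, β j ω) atTop
      (𝓝 (-l)) := by
    have h1 : Tendsto (fun k => ∑' j, r j - ∑ j ∈ Finset.range k, r j) atTop (𝓝 0) := by
      simpa using hr.hasSum.tendsto_sum_nat.const_sub (∑' j, r j)
    have h2 := hω.neg.sub h1
    rw [sub_zero] at h2
    refine h2.congr fun k => ?_
    simp only [hY]; ring
  obtain ⟨B, hB⟩ := hsumβ.bddAbove_range
  have hβs : Summable fun k => β k ω :=
    summable_of_sum_range_le (c := B) (fun k => hβ0 k ω) fun k =>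
      le_trans (le_add_of_nonneg_left (hV0 k ω)) (hB ⟨k, rfl⟩)
  refine ⟨⟨-l - ∑' k, β k ω, ?_⟩, hβs⟩
  exact (hsumβ.sub hβs.hasSum.tendsto_sum_nat).congr fun k => add_sub_cancel_right _ _

/-- If `ξ` is independent of `𝒢` and `Y` is `𝒢`-measurable, then a bound on the mean of `f y ξ` for
each frozen `y` gives the conditional bound for `f Y ξ`. -/
theorem setIntegral_le_of_indep {Ω : Type*} {𝒢 mΩ : MeasurableSpace Ω} {P : Measure Ω}
    [IsProbabilityMeasure P] (h𝒢 : 𝒢 ≤ mΩ) {E F : Type*} [MeasurableSpace E] [MeasurableSpace F]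
    {Y : Ω → E} {ξ : Ω → F}
    (hY : Measurable[𝒢] Y) (hξ : Measurable ξ)
    (hind : Indep (MeasurableSpace.comap ξ inferInstance) 𝒢 P)
    {f : E → F → ℝ} (hf : Measurable (Function.uncurry f)) {g : E → ℝ}
    (hfi : Integrable (fun ω => f (Y ω) (ξ ω)) P) (hgi : Integrable (fun ω => g (Y ω)) P)
    (hfg : ∀ ω, ∫ z, f (Y ω) z ∂(P.map ξ) ≤ g (Y ω)) {s : Set Ω} (hs : MeasurableSet[𝒢] s) :
    ∫ ω in s, f (Y ω) (ξ ω) ∂P ≤ ∫ ω in s, g (Y ω) ∂P := by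
  have hs' := h𝒢 s hs
  set c : Ω → ℝ := s.indicator fun _ => 1 with hc
  have hcm : Measurable[𝒢] c := Measurable.indicator measurable_const hs
  have hWm : Measurable[𝒢] fun ω => (Y ω, c ω) := hY.prodMk hcm
  have hW : Measurable fun ω => (Y ω, c ω) := hWm.mono h𝒢 le_rfl
  have hindep : IndepFun (fun ω => (Y ω, c ω)) ξ P :=
    (indep_of_indep_of_le_right hind hWm.comap_le).symm
  -- the pair `(Y, 1_s)` is independent of `ξ`, so that Fubini applies to `1_s f(Y, ξ)`
  have hmap := (indepFun_iff_map_prod_eq_prod_map_map hW.aemeasurable hξ.aemeasurable).1 hindep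
  have hpair : Measurable fun ω => ((Y ω, c ω), ξ ω) := hW.prodMk hξ
  set Φ : (E × ℝ) × F → ℝ := fun q => q.1.2 * f q.1.1 q.2 with hΦ
  have hΦm : Measurable Φ := by
    have : Measurable fun q : (E × ℝ) × F => f q.1.1 q.2 :=
      hf.comp ((measurable_fst.comp measurable_fst).prodMk measurable_snd)
    exact (measurable_snd.comp measurable_fst).mul this
  have hmul : ∀ h : Ω → ℝ, ∫ ω in s, h ω ∂P = ∫ ω, c ω * h ω ∂P := by
    intro h
    rw [← integral_indicator hs']
    congr 1; ext ω
    by_cases hω : ω ∈ s <;> simp [hc, hω]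
  have hc_int : ∀ h : Ω → ℝ, Integrable h P → Integrable (fun ω => c ω * h ω) P := by
    intro h hh
    refine (hh.indicator hs').congr (ae_of_all _ fun ω => ?_)
    by_cases hω : ω ∈ s <;> simp [hc, hω]
  have hΦi : Integrable Φ ((P.map fun ω => (Y ω, c ω)).prod (P.map ξ)) := by
    rw [← hmap]
    exact (integrable_map_measure hΦm.aestronglyMeasurable hpair.aemeasurable).2 (hc_int _ hfi)
  rw [hmul, hmul]
  calc ∫ ω, c ω * f (Y ω) (ξ ω) ∂P
      = ∫ q, Φ q ∂((P.map fun ω => (Y ω, c ω)).prod (P.map ξ)) := by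
        rw [← hmap, integral_map hpair.aemeasurable hΦm.aestronglyMeasurable]
    _ = ∫ w, ∫ z, Φ (w, z) ∂(P.map ξ) ∂(P.map fun ω => (Y ω, c ω)) := integral_prod _ hΦi
    _ = ∫ ω, ∫ z, Φ ((Y ω, c ω), z) ∂(P.map ξ) ∂P :=
        integral_map hW.aemeasurable hΦi.integral_prod_left.aestronglyMeasurable
    _ ≤ ∫ ω, c ω * g (Y ω) ∂P := by
        refine integral_mono (hΦi.integral_prod_left.comp_measurable hW) (hc_int _ hgi) fun ω => ?_
        show ∫ z, c ω * f (Y ω) z ∂(P.map ξ) ≤ c ω * g (Y ω)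
        rw [integral_const_mul]
        exact mul_le_mul_of_nonneg_left (hfg ω) (Set.indicator_nonneg (fun _ _ => zero_le_one) ω)

/-! ### Almost sure convergence of the Lyapunov function -/

section

variable {m : ℕ} {α lam : ℝ}

theorem measurable_bregman (x : Vec m × ℝ) : Measurable (bregman x) := by
  unfold bregman
  have h : ∀ i, Measurable fun y : Vec m × ℝ => Real.log (y.1 i) := fun i => by fun_prop
  fun_prop

theorem measurable_step (η : ℝ) :
    Measurable fun p : (Vec m × ℝ) × Vec m => step α lam η p.2 p.1 := by
  have h1 := measurable_gradU (m := m) (α := α) (lam := lam)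
  have h2 := measurable_gradTheta (m := m) (α := α) (lam := lam)
  have h3 : ∀ i, Measurable fun p : (Vec m × ℝ) × Vec m => gradU α lam p.2 p.1 i := fun i => by
    fun_prop
  unfold step
  refine Measurable.prodMk ((WithLp.measurable_toLp 2 _).comp (measurable_pi_lambda _ fun i => ?_))
    (by fun_prop)
  refine Measurable.div (by fun_prop) (Finset.measurable_fun_sum _ fun j _ => ?_)
  exact (Measurable.mul (by fun_prop) (by fun_prop)).abs

theorem measurable_meanGrad (ν : Measure (Vec m)) [SFinite ν] (xs : Vec m × ℝ) :
    Measurable fun x => meanGrad ν α lam x (x - xs) := by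
  have h := (measurable_gradForm (α := α) (lam := lam) (fun x : Vec m × ℝ => x - xs)
    (by fun_prop)).stronglyMeasurable
  exact (StronglyMeasurable.integral_prod_right (ν := ν) h).measurable

/-- Along the iterates, the Lyapunov function at `xs` converges almost surely and the mean
directional gradients, taken under the laws of the samples, are summable against the steps. The
hypothesis `hc` says that these gradients are nonnegative up to summable errors; convexity
provides it when `xs` is a minimizer. -/
theorem ae_bregman_tendsto (hα : α ∈ Set.Ioo (0 : ℝ) 1) (hlam : 0 < lam)
    {Ω : Type*} [mΩ : MeasurableSpace Ω] {P : Measure Ω} [IsProbabilityMeasure P]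
    {ξ : ℕ → Ω → Vec m} (hξ : ∀ k, Measurable (ξ k)) (hindep : iIndepFun (fun k => ξ (k + 1)) P)
    (hint : ∀ k, Integrable (fun z => ‖z‖) (P.map (ξ (k + 1))))
    {η : ℕ → ℝ} (hη : ∀ k, 0 < η k) (hη2 : Summable fun k => η (k + 1) ^ 2)
    (htr : Summable fun k =>
      ∫ z, truncSq (η (k + 1) * gradBound α lam * ‖z‖) ∂(P.map (ξ (k + 1))))
    {X : ℕ → Ω → Vec m × ℝ} {x₀ : Vec m × ℝ} (hx₀ : x₀ ∈ interiorFeasible m)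
    (hX0 : ∀ ω, X 0 ω = x₀)
    (hXs : ∀ k ω, X (k + 1) ω = step α lam (η (k + 1)) (ξ (k + 1) ω) (X k ω))
    {xs : Vec m × ℝ} (hxs : xs ∈ feasible m) {c : ℕ → ℝ} (hc0 : ∀ k, 0 ≤ c k)
    (hcs : Summable fun k => η (k + 1) * c k)
    (hc : ∀ k, ∀ x ∈ interiorFeasible m,
      -c k ≤ meanGrad (P.map (ξ (k + 1))) α lam x (x - xs)) :
    ∀ᵐ ω ∂P, (∃ l, Tendsto (fun k => bregman xs (X k ω)) atTop (𝓝 l)) ∧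
      Summable fun k =>
        η (k + 1) * meanGrad (P.map (ξ (k + 1))) α lam (X k ω) (X k ω - xs) := by
  have hprob : ∀ k, IsProbabilityMeasure (P.map (ξ k)) := fun k =>
    Measure.isProbabilityMeasure_map (hξ k).aemeasurable
  set L := gradBound α lam with hL
  have hLpos : 0 < L := gradBound_pos hα hlam
  set ℱ := Filtration.natural (fun k => ξ (k + 1)) fun k => (hξ (k + 1)).stronglyMeasurable with hℱ
  have hXint : ∀ k ω, X k ω ∈ interiorFeasible m := by
    intro k ω
    induction k with
    | zero => rw [hX0]; exact hx₀
    | succ k ih => rw [hXs]; exact step_mem_interiorFeasible ih _ _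
  have hXb : ∀ k, ∃ D, ∀ ω, ‖X k ω‖ ≤ D := by
    have hθ : ∀ k, ∃ D, ∀ ω, |(X k ω).2| ≤ D := by
      intro k
      induction k with
      | zero => exact ⟨|x₀.2|, fun ω => by rw [hX0]⟩
      | succ k ih =>
        obtain ⟨D, hD⟩ := ih
        refine ⟨D + η (k + 1) * L, fun ω => ?_⟩
        rw [hXs]
        refine (abs_sub _ _).trans (add_le_add (hD ω) ?_)
        rw [abs_mul, abs_of_pos (hη _)]
        exact mul_le_mul_of_nonneg_left (abs_gradTheta_le hα hlam _ _) (hη _).le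
    intro k
    obtain ⟨D, hD⟩ := hθ k
    exact ⟨max 1 D, fun ω => max_le_max (norm_fst_le_one (hXint k ω).1) (hD ω)⟩
  have hξF : ∀ k, Measurable[ℱ k] (ξ (k + 1)) := fun k =>
    (Filtration.stronglyAdapted_natural (u := fun k => ξ (k + 1))
      fun k => (hξ (k + 1)).stronglyMeasurable) k |>.measurable
  have hXF : ∀ k, Measurable[ℱ k] (X (k + 1)) := by
    intro k
    have hstep : ∀ k, Measurable[ℱ k] (X k) → Measurable[ℱ k] (X (k + 1)) := by
      intro k hk
      have h := (measurable_step (m := m) (α := α) (lam := lam) (η (k + 1))).comp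
        (hk.prodMk (hξF k))
      have e : X (k + 1) = (fun p : (Vec m × ℝ) × Vec m => step α lam (η (k + 1)) p.2 p.1) ∘
          fun ω => (X k ω, ξ (k + 1) ω) := by ext1 ω; exact hXs k ω
      rw [e]; exact h
    induction k with
    | zero =>
      refine hstep 0 ?_
      rw [show X 0 = fun _ => x₀ from funext hX0]
      exact measurable_const
    | succ k ih => exact hstep (k + 1) (ih.mono (ℱ.mono k.le_succ) le_rfl)
  have hXm : ∀ k, Measurable (X k) := by
    intro k
    cases k with
    | zero =>
      rw [show X 0 = fun _ => x₀ from funext hX0]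
      exact measurable_const
    | succ k => exact (hXF k).mono (ℱ.le k) le_rfl
  have hnormξ : ∀ k, Integrable (fun ω => ‖ξ (k + 1) ω‖) P := fun k =>
    (hint k).comp_measurable (hξ (k + 1))
  -- the remainder of one step, for the sample `z`
  set ρ : ℕ → Vec m → ℝ := fun k z =>
    2 * truncSq (η (k + 1) * L * ‖z‖) + (η (k + 1) * L) ^ 2 with hρ
  have htm : ∀ k, Measurable fun z : Vec m => truncSq (η (k + 1) * L * ‖z‖) := fun k => by
    unfold truncSq; fun_prop
  have hscale : ∀ k (z : Vec m), 0 ≤ η (k + 1) * L * ‖z‖ := fun k z =>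
    mul_nonneg (mul_nonneg (hη _).le hLpos.le) (norm_nonneg _)
  have hti : ∀ k, Integrable (fun z => truncSq (η (k + 1) * L * ‖z‖)) (P.map (ξ (k + 1))) := by
    intro k
    refine ((hint k).const_mul (η (k + 1) * L)).mono' (htm k).aestronglyMeasurable
      (ae_of_all _ fun z => ?_)
    rw [Real.norm_of_nonneg (truncSq_nonneg (hscale k z))]
    exact min_le_left _ _
  have hρi : ∀ k, Integrable (ρ k) (P.map (ξ (k + 1))) := fun k =>
    ((hti k).const_mul 2).add (integrable_const _)
  have hdec : ∀ k x z, x ∈ interiorFeasible m → bregman xs (step α lam (η (k + 1)) z x) ≤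
      bregman xs x - η (k + 1) * gradForm α lam x z (x - xs) + ρ k z := fun k x z hx =>
    bregman_step_le hα hlam hxs hx (hη _).le z
  have hVi : ∀ k, Integrable (fun ω => bregman xs (X k ω)) P := by
    intro k
    induction k with
    | zero => simp_rw [hX0]; exact integrable_const _
    | succ k ih =>
      obtain ⟨D, hD⟩ := hXb k
      have hbound : Integrable (fun ω => bregman xs (X k ω) +
          η (k + 1) * (L * (‖ξ (k + 1) ω‖ + 1) * (D + ‖xs‖)) + ρ k (ξ (k + 1) ω)) P := by
        have h1 : Integrable (fun ω => ‖ξ (k + 1) ω‖ + 1) P := (hnormξ k).add (integrable_const 1)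
        exact (ih.add (((h1.const_mul L).mul_const _).const_mul _)).add
          ((hρi k).comp_measurable (hξ (k + 1)))
      refine hbound.mono' ((measurable_bregman xs).comp (hXm (k + 1))).aestronglyMeasurable
        (ae_of_all _ fun ω => ?_)
      rw [Real.norm_of_nonneg (bregman_nonneg hxs (hXint _ ω)), hXs]
      refine (hdec k _ _ (hXint k ω)).trans ?_
      have h1 := (abs_le.1 (abs_gradForm_le hα hlam (X k ω) (X k ω - xs) (ξ (k + 1) ω))).1
      have h2 : ‖X k ω - xs‖ ≤ D + ‖xs‖ := (norm_sub_le _ _).trans (by gcongr; exact hD ω)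
      have h3 : L * (‖ξ (k + 1) ω‖ + 1) * ‖X k ω - xs‖ ≤
          L * (‖ξ (k + 1) ω‖ + 1) * (D + ‖xs‖) := by gcongr
      nlinarith [hη (k + 1)]
  set G : ℕ → Vec m × ℝ → ℝ := fun k x => meanGrad (P.map (ξ (k + 1))) α lam x (x - xs) with hG
  have hGm : ∀ k, Measurable (G k) := fun k => measurable_meanGrad _ _
  have hGi : ∀ k, Integrable (fun ω => G k (X k ω)) P := by
    intro k
    obtain ⟨D, hD⟩ := hXb k
    refine (integrable_const (L * (∫ z, ‖z‖ ∂(P.map (ξ (k + 1))) + 1) * (D + ‖xs‖))).mono'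
      ((hGm k).comp (hXm k)).aestronglyMeasurable (ae_of_all _ fun ω => ?_)
    refine (abs_meanGrad_le hα hlam (hint k) _ _).trans ?_
    have h2 : ‖X k ω - xs‖ ≤ D + ‖xs‖ := (norm_sub_le _ _).trans (by gcongr; exact hD ω)
    have h3 : 0 ≤ ∫ z, ‖z‖ ∂(P.map (ξ (k + 1))) := integral_nonneg fun _ => norm_nonneg _
    gcongr
  set r : ℕ → ℝ := fun k => ∫ z, ρ k z ∂(P.map (ξ (k + 1))) + η (k + 1) * c k with hr
  have hρ0 : ∀ k z, 0 ≤ ρ k z := fun k z =>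
    add_nonneg (mul_nonneg zero_le_two (truncSq_nonneg (hscale k z))) (sq_nonneg _)
  have hr0 : ∀ k, 0 ≤ r k := fun k =>
    add_nonneg (integral_nonneg (hρ0 k)) (mul_nonneg (hη _).le (hc0 k))
  have hrs : Summable r := by
    refine Summable.add ?_ hcs
    have e : ∀ k, ∫ z, ρ k z ∂(P.map (ξ (k + 1))) =
        2 * ∫ z, truncSq (η (k + 1) * L * ‖z‖) ∂(P.map (ξ (k + 1))) + η (k + 1) ^ 2 * L ^ 2 := by
      intro k
      simp only [hρ]
      rw [integral_add ((hti k).const_mul 2) (integrable_const _), integral_const_mul]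
      simp [mul_pow]
    simp_rw [e]
    exact (htr.mul_left 2).add (hη2.mul_right _)
  have hmean : ∀ k x, x ∈ interiorFeasible m →
      ∫ z, bregman xs (step α lam (η (k + 1)) z x) ∂(P.map (ξ (k + 1))) ≤
        bregman xs x - (η (k + 1) * G k x + η (k + 1) * c k) + r k := by
    intro k x hx
    have i1 := integrable_gradForm hα hlam (hint k) x (x - xs)
    have i2 : Integrable (fun z => bregman xs x - η (k + 1) * gradForm α lam x z (x - xs))
        (P.map (ξ (k + 1))) := (integrable_const _).sub (i1.const_mul _)
    calc _ ≤ ∫ z, (bregman xs x - η (k + 1) * gradForm α lam x z (x - xs) + ρ k z)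
          ∂(P.map (ξ (k + 1))) :=
          integral_mono_of_nonneg
            (ae_of_all _ fun z => bregman_nonneg hxs (step_mem_interiorFeasible hx _ _))
            (i2.add (hρi k)) (ae_of_all _ fun z => hdec k x z hx)
      _ = _ := by
        rw [integral_add i2 (hρi k), integral_sub (integrable_const _) (i1.const_mul _),
          integral_const_mul, integral_const, probReal_univ, one_smul]
        simp only [hr, hG, meanGrad]
        ring
  -- `X (k + 1)` is measurable with respect to the σ-algebra of the first `k + 1` samples, which is
  -- `ℱ k`, so that the filtration calls for a shift by one
  have hRS := robbins_siegmund (P := P) (ℱ := ℱ)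
    (V := fun k ω => bregman xs (X (k + 1) ω))
    (β := fun k ω => η (k + 1 + 1) * G (k + 1) (X (k + 1) ω) + η (k + 1 + 1) * c (k + 1))
    (r := fun k => r (k + 1))
    (fun k => ((measurable_bregman xs).comp (hXF k)).stronglyMeasurable)
    (fun k => ((((hGm (k + 1)).comp (hXF k)).const_mul _).add_const _).stronglyMeasurable)
    (fun k => hVi (k + 1)) (fun k => ((hGi (k + 1)).const_mul _).add (integrable_const _))
    (fun k ω => bregman_nonneg hxs (hXint _ ω))
    (fun k ω => by
      have := hc (k + 1) _ (hXint (k + 1) ω)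
      rw [← mul_add]
      exact mul_nonneg (hη _).le (by simp only [hG]; linarith))
    (fun k => hr0 _) ((summable_nat_add_iff 1).2 hrs)
    (fun k s hs => by
      have hind := hindep.indep_comap_natural_of_lt
        (fun k => (hξ (k + 1)).stronglyMeasurable) k.lt_succ_self
      have hf : Measurable (Function.uncurry fun (x : Vec m × ℝ) (z : Vec m) =>
          bregman xs (step α lam (η (k + 1 + 1)) z x)) :=
        (measurable_bregman xs).comp (measurable_step _)
      have hVs := hVi (k + 1 + 1)
      simp_rw [hXs (k + 1)] at hVs ⊢
      exact setIntegral_le_of_indep (ℱ.le k) (hXF k) (hξ (k + 1 + 1)) hind hf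
        (g := fun x => bregman xs x - (η (k + 1 + 1) * G (k + 1) x + η (k + 1 + 1) * c (k + 1)) +
          r (k + 1)) hVs
        (((hVi (k + 1)).sub (((hGi (k + 1)).const_mul _).add (integrable_const _))).add
          (integrable_const _))
        (fun ω => hmean (k + 1) _ (hXint (k + 1) ω)) hs)
  filter_upwards [hRS] with ω hω
  obtain ⟨⟨l, hl⟩, hs⟩ := hω
  refine ⟨⟨l, (tendsto_add_atTop_iff_nat (f := fun k => bregman xs (X k ω)) 1).1 hl⟩, ?_⟩
  have h1 : Summable fun k => η (k + 1) * G k (X k ω) + η (k + 1) * c k :=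
    (summable_nat_add_iff (f := fun k => η (k + 1) * G k (X k ω) + η (k + 1) * c k) 1).1 hs
  exact (h1.sub hcs).congr fun k => add_sub_cancel_right _ _

end

/-! ### Consequences of the bias bounds -/

section

variable {m : ℕ} {α lam : ℝ}

theorem integrable_ind {μ : Measure (Vec m)} [IsProbabilityMeasure μ] (x : Vec m × ℝ) :
    Integrable (ind x) μ :=
  (integrable_const (1 : ℝ)).mono' (measurable_ind_left x).aestronglyMeasurable
    (ae_of_all _ fun z => by rw [Real.norm_of_nonneg (ind_nonneg x z)]; exact ind_le_one x z)

theorem integrable_ind_smul {μ : Measure (Vec m)} (hμ : Integrable (fun z => ‖z‖) μ)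
    (x : Vec m × ℝ) : Integrable (fun z => ind x z • z) μ := by
  have := measurable_ind_left x
  refine hμ.mono' (by fun_prop) (ae_of_all _ fun z => ?_)
  rw [norm_smul, Real.norm_of_nonneg (ind_nonneg x z)]
  exact mul_le_of_le_one_left (norm_nonneg z) (ind_le_one x z)

theorem integrable_inner_mul_ind {μ : Measure (Vec m)} (hμ : Integrable (fun z => ‖z‖) μ)
    (u : Vec m) (x : Vec m × ℝ) : Integrable (fun z => inner ℝ z u * ind x z) μ := by
  have := measurable_ind_left x
  refine (integrable_inner hμ u).norm.mono' (by fun_prop) (ae_of_all _ fun z => ?_)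
  rw [norm_mul, Real.norm_of_nonneg (ind_nonneg x z)]
  exact mul_le_of_le_one_right (norm_nonneg _) (ind_le_one x z)

section

variable {μ ν : Measure (Vec m)} [IsProbabilityMeasure μ] [IsProbabilityMeasure ν]
  (hμ : Integrable (fun z => ‖z‖) μ) (hν : Integrable (fun z => ‖z‖) ν)
include hμ hν

omit [IsProbabilityMeasure μ] [IsProbabilityMeasure ν] in
/-- Letting the threshold tend to `-∞`, the bias bound also controls the means. -/
theorem abs_integral_inner_sub_le {u : Vec m} {υ : ℝ}
    (hb : ∀ θ : ℝ, |∫ z, inner ℝ z u * ind (u, θ) z ∂ν - ∫ z, inner ℝ z u * ind (u, θ) z ∂μ| ≤ υ) :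
    |∫ z, inner ℝ z u ∂ν - ∫ z, inner ℝ z u ∂μ| ≤ υ := by
  have hlim : ∀ π : Measure (Vec m), Integrable (fun z => ‖z‖) π →
      Tendsto (fun n : ℕ => ∫ z, inner ℝ z u * ind (u, -(n : ℝ)) z ∂π) atTop
        (𝓝 (∫ z, inner ℝ z u ∂π)) := by
    intro π hπ
    refine tendsto_integral_of_dominated_convergence (fun z => ‖inner ℝ z u‖)
      (fun n => (integrable_inner_mul_ind hπ u _).aestronglyMeasurable)
      (integrable_inner hπ u).norm (fun n => ae_of_all _ fun z => ?_) (ae_of_all _ fun z => ?_)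
    · rw [norm_mul, Real.norm_of_nonneg (ind_nonneg _ z)]
      exact mul_le_of_le_one_right (norm_nonneg _) (ind_le_one _ z)
    · obtain ⟨N, hN⟩ := exists_nat_ge (-inner ℝ z u)
      refine tendsto_const_nhds.congr' ?_
      filter_upwards [eventually_ge_atTop N] with n hn
      have : (N : ℝ) ≤ n := by exact_mod_cast hn
      rw [ind_eq_ite, if_pos (by simp only; linarith), mul_one]
  exact le_of_tendsto ((hlim ν hν).sub (hlim μ hμ)).abs (Eventually.of_forall fun n => hb _)

omit [IsProbabilityMeasure μ] [IsProbabilityMeasure ν] in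
/-- The bias bound at `θ = 0`, together with that on the means, controls the mean of `|z i|`, and
hence the first moment of `μ`. -/
theorem integral_norm_le_of_bias {υ : ℝ}
    (hb : ∀ u ∈ simplex m, ∀ θ : ℝ,
      |∫ z, inner ℝ z u * ind (u, θ) z ∂ν - ∫ z, inner ℝ z u * ind (u, θ) z ∂μ| ≤ υ) :
    ∫ z, ‖z‖ ∂μ ≤ m * (∫ z, ‖z‖ ∂ν + 3 * υ) := by
  have hco : ∀ i : Fin m, ∫ z, |z i| ∂μ ≤ ∫ z, ‖z‖ ∂ν + 3 * υ := by
    intro i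
    set e : Vec m := EuclideanSpace.single i 1 with he
    have hin : ∀ z : Vec m, inner ℝ z e = z i := fun z => by
      simp [he, EuclideanSpace.inner_single_right]
    have hes : e ∈ simplex m := by
      refine ⟨fun j => ?_, by simp [he]⟩
      by_cases h : j = i <;> simp [he, h]
    have habs : ∀ z : Vec m, |z i| = 2 * (inner ℝ z e * ind (e, 0) z) - inner ℝ z e := by
      intro z
      rw [ind_eq_ite]
      simp only [hin]
      split_ifs with h
      · rw [abs_of_nonneg h]; ring
      · rw [abs_of_neg (not_le.1 h)]; ring
    have hint : ∀ π : Measure (Vec m), Integrable (fun z => ‖z‖) π →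
        ∫ z, |z i| ∂π = 2 * ∫ z, inner ℝ z e * ind (e, 0) z ∂π - ∫ z, inner ℝ z e ∂π := by
      intro π hπ
      simp_rw [habs]
      rw [integral_sub ((integrable_inner_mul_ind hπ e _).const_mul 2) (integrable_inner hπ e),
        integral_const_mul]
    have h1 := (abs_le.1 (hb e hes 0)).1
    have h2 := (abs_le.1 (abs_integral_inner_sub_le hμ hν (hb e hes))).2
    have h3 : ∫ z, |z i| ∂ν ≤ ∫ z, ‖z‖ ∂ν :=
      integral_mono_of_nonneg (ae_of_all _ fun z => abs_nonneg _) hν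
        (ae_of_all _ fun z => PiLp.norm_apply_le z i)
    rw [hint ν hν] at h3
    rw [hint μ hμ]
    linarith
  have hnorm : ∀ z : Vec m, ‖z‖ ≤ ∑ i, |z i| := by
    intro z
    have h := (EuclideanSpace.basisFun (Fin m) ℝ).sum_repr z
    calc ‖z‖ = ‖∑ i, z i • EuclideanSpace.basisFun (Fin m) ℝ i‖ := by
          nth_rewrite 1 [← h]; simp
      _ ≤ ∑ i, ‖z i • EuclideanSpace.basisFun (Fin m) ℝ i‖ := norm_sum_le _ _
      _ = _ := by simp [norm_smul]
  have hci : ∀ i : Fin m, Integrable (fun z : Vec m => |z i|) μ := fun i =>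
    hμ.mono' (by fun_prop) (ae_of_all _ fun z => by
      rw [Real.norm_eq_abs, abs_abs]; exact PiLp.norm_apply_le z i)
  calc ∫ z, ‖z‖ ∂μ ≤ ∫ z, ∑ i, |z i| ∂μ :=
        integral_mono hμ (integrable_finsetSum _ fun i _ => hci i) hnorm
    _ = ∑ i, ∫ z, |z i| ∂μ := integral_finsetSum _ fun i _ => hci i
    _ ≤ ∑ _i : Fin m, (∫ z, ‖z‖ ∂ν + 3 * υ) := Finset.sum_le_sum fun i _ => hco i
    _ = _ := by rw [Finset.sum_const, Finset.card_univ, Fintype.card_fin, nsmul_eq_mul]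

/-- The two bias bounds together make the Wasserstein distance of order `√δ + υ`: for small `δ`
because `δ ≤ √δ`, and for large `δ` because the first moment of `μ` is of order `1 + υ`. -/
theorem wasserstein1_toReal_le {δ υ : ℝ} (hW : wasserstein1 μ ν ≤ ENNReal.ofReal δ) (hυ : 0 ≤ υ)
    (hb : ∀ u ∈ simplex m, ∀ θ : ℝ,
      |∫ z, inner ℝ z u * ind (u, θ) z ∂ν - ∫ z, inner ℝ z u * ind (u, θ) z ∂μ| ≤ υ) :
    (wasserstein1 μ ν).toReal ≤ (1 + (m + 1) * ∫ z, ‖z‖ ∂ν + 3 * m) * (√δ + υ) := by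
  have h0 : 0 ≤ ∫ z, ‖z‖ ∂ν := integral_nonneg fun _ => norm_nonneg _
  have hm : (0 : ℝ) ≤ m := Nat.cast_nonneg m
  have hs := Real.sqrt_nonneg δ
  have hA : 0 ≤ (m + 1) * ∫ z, ‖z‖ ∂ν := by positivity
  rcases le_total δ 1 with h | h
  · have h1 : (wasserstein1 μ ν).toReal ≤ max δ 0 := by
      rw [← ENNReal.toReal_ofReal']
      exact ENNReal.toReal_mono ENNReal.ofReal_ne_top hW
    have h2 : max δ 0 ≤ √δ := by
      refine max_le ?_ hs
      rcases le_total δ 0 with h' | h'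
      · exact h'.trans hs
      · exact Real.le_sqrt_of_sq_le (by nlinarith)
    nlinarith
  · have h1 := wasserstein1_toReal_le_moments hμ hν
    have h2 := integral_norm_le_of_bias hμ hν hb
    have h3 : 1 ≤ √δ := Real.one_le_sqrt.2 h
    nlinarith [mul_nonneg hA hυ, mul_nonneg hm hυ]

/-- The bias on `⟨z, u⟩ 1_{⟨z, u⟩ ≥ θ}` and the Wasserstein distance control that of
`θ 1_{⟨z, u⟩ ≥ θ}`, since their difference is a positive part. -/
theorem abs_mul_abs_integral_ind_sub_le (hW : wasserstein1 μ ν ≠ ⊤) {x : Vec m × ℝ}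
    (hx : x ∈ feasible m) {υ : ℝ}
    (hb : |∫ z, inner ℝ z x.1 * ind x z ∂ν - ∫ z, inner ℝ z x.1 * ind x z ∂μ| ≤ υ) :
    |x.2| * |∫ z, ind x z ∂μ - ∫ z, ind x z ∂ν| ≤ (wasserstein1 μ ν).toReal + υ := by
  have hmax : ∀ z : Vec m, max 0 (inner ℝ z x.1 - x.2) =
      inner ℝ z x.1 * ind x z - x.2 * ind x z := by
    intro z
    rw [ind_eq_ite]
    split_ifs with h
    · rw [max_eq_right (by linarith)]; ring
    · rw [max_eq_left (by linarith)]; ring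
  have hint : ∀ π : Measure (Vec m), IsProbabilityMeasure π → Integrable (fun z => ‖z‖) π →
      Integrable (fun z => max 0 (inner ℝ z x.1 - x.2)) π ∧
      ∫ z, max 0 (inner ℝ z x.1 - x.2) ∂π =
        ∫ z, inner ℝ z x.1 * ind x z ∂π - x.2 * ∫ z, ind x z ∂π := by
    intro π _ hπ
    simp_rw [hmax]
    have h1 := integrable_inner_mul_ind hπ x.1 x
    have h2 := (integrable_ind (μ := π) x).const_mul x.2
    exact ⟨h1.sub h2, by rw [integral_sub h1 h2, integral_const_mul]⟩
  obtain ⟨i1, e1⟩ := hint μ inferInstance hμ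
  obtain ⟨i2, e2⟩ := hint ν inferInstance hν
  have hlip := abs_integral_sub_le_wasserstein1 hW zero_le_one (by fun_prop) i1 i2 fun z z' => by
    have h2 := abs_max_sub_max_le_abs (inner ℝ z x.1 - x.2) (inner ℝ z' x.1 - x.2) 0
    rw [max_comm, max_comm (inner ℝ z' x.1 - x.2), sub_sub_sub_cancel_right,
      ← inner_sub_left] at h2
    rw [one_mul]
    exact h2.trans ((abs_real_inner_le_norm _ _).trans
      (mul_le_of_le_one_right (norm_nonneg _) (norm_fst_le_one hx)))
  rw [e1, e2, one_mul] at hlip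
  rw [← abs_mul]
  rw [abs_le] at *
  constructor <;> nlinarith

omit hμ hν in
/-- Bounded densities turn closeness in Wasserstein distance into closeness of the probabilities
of half-spaces: an error `d` on the sample matters only if it exceeds `ε` or if `⟨z, u⟩` lies
within `ε` of the threshold. -/
theorem abs_integral_ind_sub_le_sqrt {δ : ℝ} (hW : wasserstein1 μ ν ≤ ENNReal.ofReal δ)
    {x : Vec m × ℝ} (hx : x ∈ feasible m) {C : ℝ≥0}
    (hC : ν.map (fun z => inner ℝ z x.1) ≤ C • (volume : Measure ℝ)) :
    |∫ z, ind x z ∂μ - ∫ z, ind x z ∂ν| ≤ (2 * C + 1) * √δ := by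
  have hWtop : wasserstein1 μ ν ≠ ⊤ := ne_top_of_le_ne_top ENNReal.ofReal_ne_top hW
  have hw : (wasserstein1 μ ν).toReal ≤ √δ ^ 2 := by
    have h1 : (wasserstein1 μ ν).toReal ≤ max δ 0 := by
      rw [← ENNReal.toReal_ofReal']
      exact ENNReal.toReal_mono ENNReal.ofReal_ne_top hW
    rcases le_total 0 δ with h | h
    · rwa [Real.sq_sqrt h, ← max_eq_left h]
    · rw [max_eq_right h] at h1; exact h1.trans (sq_nonneg _)
  have hin : Measurable fun z : Vec m => inner ℝ z x.1 := by fun_prop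
  have key : ∀ ε : ℝ, 0 < ε → |∫ z, ind x z ∂μ - ∫ z, ind x z ∂ν| ≤
      2 * C * ε + ε⁻¹ * (wasserstein1 μ ν).toReal := by
    intro ε hε
    set s : Set (Vec m) := (fun z => inner ℝ z x.1) ⁻¹' Set.Icc (x.2 - ε) (x.2 + ε) with hs
    have hsm : MeasurableSet s := hin measurableSet_Icc
    have hνs : ν.real s ≤ 2 * C * ε := by
      have h1 : ν s ≤ ENNReal.ofReal (2 * C * ε) := by
        rw [hs, ← Measure.map_apply hin measurableSet_Icc]
        refine (hC _).trans_eq ?_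
        rw [Measure.smul_apply, Real.volume_Icc, ENNReal.smul_def, smul_eq_mul,
          ← ENNReal.ofReal_coe_nnreal, ← ENNReal.ofReal_mul (NNReal.coe_nonneg C)]
        congr 1; ring
      have h2 : (0 : ℝ) ≤ 2 * C * ε := by positivity
      exact ENNReal.toReal_le_of_le_ofReal h2 h1
    have hsi : Integrable (s.indicator fun _ => (1 : ℝ)) ν := (integrable_const 1).indicator hsm
    have hsint : ∫ z, s.indicator (fun _ => (1 : ℝ)) z ∂ν = ν.real s := by
      rw [integral_indicator hsm]; simp
    have hpt : ∀ z z' : Vec m, |ind x z - ind x z'| ≤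
        s.indicator (fun _ => (1 : ℝ)) z' + ε⁻¹ * ‖z - z'‖ := by
      intro z z'
      have h01 : |ind x z - ind x z'| ≤ 1 := by
        rw [abs_le]
        constructor <;> linarith [ind_nonneg x z, ind_nonneg x z', ind_le_one x z, ind_le_one x z']
      have hd : |inner ℝ z x.1 - inner ℝ z' x.1| ≤ ‖z - z'‖ := by
        rw [← inner_sub_left]
        exact (abs_real_inner_le_norm _ _).trans
          (mul_le_of_le_one_right (norm_nonneg _) (norm_fst_le_one hx))
      by_cases hz : z' ∈ s
      · rw [Set.indicator_of_mem hz]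
        have : 0 ≤ ε⁻¹ * ‖z - z'‖ := by positivity
        linarith
      · rw [Set.indicator_of_notMem hz, zero_add]
        by_cases hd' : ε ≤ ‖z - z'‖
        · refine h01.trans ?_
          rw [inv_mul_eq_div, le_div_iff₀ hε]; linarith
        · have h2 := abs_lt.1 (hd.trans_lt (not_le.1 hd'))
          have hout : inner ℝ z' x.1 < x.2 - ε ∨ x.2 + ε < inner ℝ z' x.1 := by
            by_contra! hcon
            exact hz hcon
          have hsame : ind x z = ind x z' := by
            rw [ind_eq_ite, ind_eq_ite]
            rcases hout with h | h
            · rw [if_neg (by linarith), if_neg (by linarith)]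
            · rw [if_pos (by linarith), if_pos (by linarith)]
          rw [hsame, sub_self, abs_zero]; positivity
    have h1 := integral_le_add_wasserstein1 hWtop (inv_nonneg.2 hε.le) (measurable_ind_left x)
      ((measurable_ind_left x).add (measurable_const.indicator hsm)) (integrable_ind x)
      ((integrable_ind x).add hsi)
      fun z z' => by have := (abs_le.1 (hpt z z')).2; simp only [Pi.add_apply]; linarith
    have h2 := integral_le_add_wasserstein1 hWtop (inv_nonneg.2 hε.le) (measurable_ind_left x).neg
      ((measurable_ind_left x).neg.add (measurable_const.indicator hsm)) (integrable_ind x).neg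
      ((integrable_ind x).neg.add hsi)
      fun z z' => by
        have := (abs_le.1 (hpt z z')).1; simp only [Pi.add_apply, Pi.neg_apply]; linarith
    simp only [Pi.add_apply, Pi.neg_apply] at h1 h2
    rw [integral_add (integrable_ind x) hsi, hsint] at h1
    rw [integral_neg, integral_add (integrable_ind x).fun_neg hsi, integral_neg, hsint] at h2
    rw [abs_le]
    constructor <;> linarith
  -- `ε = √δ + t` balances the two terms; `t > 0` covers the case `δ ≤ 0`
  have key2 : ∀ t : ℝ, 0 < t → |∫ z, ind x z ∂μ - ∫ z, ind x z ∂ν| ≤ (2 * C + 1) * (√δ + t) := by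
    intro t ht
    have hs := Real.sqrt_nonneg δ
    have hpos : 0 < √δ + t := by linarith
    refine (key (√δ + t) hpos).trans ?_
    have : (√δ + t)⁻¹ * (wasserstein1 μ ν).toReal ≤ √δ + t := by
      rw [inv_mul_eq_div, div_le_iff₀ hpos]
      nlinarith
    linarith
  have hlim : Tendsto (fun t : ℝ => (2 * C + 1) * (√δ + t)) (𝓝[>] 0) (𝓝 ((2 * C + 1) * √δ)) :=
    (Continuous.tendsto' (by fun_prop) _ _ (by simp)).mono_left nhdsWithin_le_nhds
  exact ge_of_tendsto hlim (eventually_nhdsWithin_of_forall fun t ht => key2 t ht)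

/-- Bias of the mean directional gradient, split into its three sources. -/
theorem abs_meanGrad_sub_le (hα : α ∈ Set.Ioo (0 : ℝ) 1) (hlam : 0 < lam)
    (hW : wasserstein1 μ ν ≠ ⊤) {x : Vec m × ℝ} {υ : ℝ}
    (hb : ‖∫ z, ind x z • z ∂ν - ∫ z, ind x z • z ∂μ‖ ≤ υ) (v : Vec m × ℝ) :
    |meanGrad μ α lam x v - meanGrad ν α lam x v| ≤
      gradBound α lam * (‖v.1‖ * ((wasserstein1 μ ν).toReal + υ) +
        |v.2| * |∫ z, ind x z ∂μ - ∫ z, ind x z ∂ν|) := by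
  have ha := lam_div_pos hα hlam
  have hform : ∀ π : Measure (Vec m), IsProbabilityMeasure π → Integrable (fun z => ‖z‖) π →
      meanGrad π α lam x v = -∫ z, inner ℝ z v.1 ∂π +
        lam / (1 - α) * inner ℝ (∫ z, ind x z • z ∂π) v.1 + lam * v.2 -
          lam / (1 - α) * v.2 * ∫ z, ind x z ∂π := by
    intro π _ hπ
    have i1 := integrable_inner hπ v.1
    have i2 : Integrable (fun z => inner ℝ v.1 (ind x z • z)) π :=
      (integrable_ind_smul hπ x).const_inner v.1
    have i3 := integrable_ind (μ := π) x
    have e : ∀ z, gradForm α lam x z v = -inner ℝ z v.1 +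
        lam / (1 - α) * inner ℝ v.1 (ind x z • z) + lam * v.2 -
          lam / (1 - α) * v.2 * ind x z := by
      intro z
      rw [gradForm_apply, gradU, gradTheta, inner_add_left, inner_neg_left, real_inner_smul_left,
        real_inner_smul_right, real_inner_comm v.1]
      ring
    have i4 : Integrable (fun z => -inner ℝ z v.1) π := i1.neg
    have i5 : Integrable (fun z => -inner ℝ z v.1 +
        lam / (1 - α) * inner ℝ v.1 (ind x z • z)) π := i4.add (i2.const_mul _)
    have i6 : Integrable (fun z => -inner ℝ z v.1 +
        lam / (1 - α) * inner ℝ v.1 (ind x z • z) + lam * v.2) π := i5.add (integrable_const _)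
    unfold meanGrad
    simp_rw [e]
    rw [integral_sub i6 (i3.const_mul _), integral_add i5 (integrable_const _),
      integral_add i4 (i2.const_mul _), integral_neg, integral_const_mul, integral_const_mul,
      integral_inner (integrable_ind_smul hπ x), integral_const, probReal_univ, one_smul,
      real_inner_comm v.1, integral_const_mul]
  have h1 : |∫ z, inner ℝ z v.1 ∂μ - ∫ z, inner ℝ z v.1 ∂ν| ≤
      ‖v.1‖ * (wasserstein1 μ ν).toReal :=
    abs_integral_sub_le_wasserstein1 hW (norm_nonneg _) (by fun_prop) (integrable_inner hμ _)
      (integrable_inner hν _) fun z z' => by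
        rw [← inner_sub_left, mul_comm]; exact abs_real_inner_le_norm _ _
  have h2 : |inner ℝ (∫ z, ind x z • z ∂μ) v.1 - inner ℝ (∫ z, ind x z • z ∂ν) v.1| ≤
      ‖v.1‖ * υ := by
    rw [← inner_sub_left, mul_comm]
    refine (abs_real_inner_le_norm _ _).trans ?_
    rw [norm_sub_rev]
    gcongr
  have e : meanGrad μ α lam x v - meanGrad ν α lam x v =
      -(∫ z, inner ℝ z v.1 ∂μ - ∫ z, inner ℝ z v.1 ∂ν) +
      lam / (1 - α) *
        (inner ℝ (∫ z, ind x z • z ∂μ) v.1 - inner ℝ (∫ z, ind x z • z ∂ν) v.1) -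
      lam / (1 - α) * (v.2 * (∫ z, ind x z ∂μ - ∫ z, ind x z ∂ν)) := by
    rw [hform μ inferInstance hμ, hform ν inferInstance hν]
    ring
  have hw0 : 0 ≤ (wasserstein1 μ ν).toReal := ENNReal.toReal_nonneg
  have hυ : 0 ≤ υ := (norm_nonneg _).trans hb
  rw [e]
  calc _ ≤ ‖v.1‖ * (wasserstein1 μ ν).toReal + lam / (1 - α) * (‖v.1‖ * υ) +
        lam / (1 - α) * (|v.2| * |∫ z, ind x z ∂μ - ∫ z, ind x z ∂ν|) := by
        refine (abs_sub _ _).trans (add_le_add ((abs_add_le _ _).trans (add_le_add ?_ ?_)) ?_)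
        · rwa [abs_neg]
        · rw [abs_mul, abs_of_pos ha]; gcongr
        · rw [abs_mul, abs_of_pos ha, abs_mul]
    _ ≤ _ := by
        unfold gradBound
        have t1 : 0 ≤ ‖v.1‖ * (wasserstein1 μ ν).toReal := by positivity
        have t2 : 0 ≤ ‖v.1‖ * υ := by positivity
        have t3 : 0 ≤ |v.2| * |∫ z, ind x z ∂μ - ∫ z, ind x z ∂ν| := by positivity
        nlinarith [mul_nonneg ha.le t1]

end

end

/-! ### Convergence of the algorithm -/

section

variable {m : ℕ}

/-- If no minimizer has threshold `0`, then the optimality gap and the threshold cannot both be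
small. A bound on `|θ_k| d_k` thus controls `d_k` up to the optimality gap, which is itself
summable against the steps. -/
theorem summable_threshold_mul {p : Vec m × ℝ → ℝ} {pmin : ℝ} (hp : ContinuousOn p (feasible m))
    (hmin : ∀ x ∈ feasible m, pmin ≤ p x) {xs : Vec m × ℝ}
    (hxs : ∀ x ∈ feasible m, p x = pmin → x.2 = 0 → xs.2 = 0)
    {y : ℕ → Vec m × ℝ} (hy : ∀ k, y k ∈ feasible m) {B : ℝ} (hB : ∀ k, |(y k - xs).2| ≤ B)
    {η d e : ℕ → ℝ} (hη : ∀ k, 0 ≤ η k) (hd0 : ∀ k, 0 ≤ d k) (hd1 : ∀ k, d k ≤ 1)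
    (hde : ∀ k, |(y k).2| * d k ≤ e k) (he : Summable fun k => η k * e k)
    (hgap : Summable fun k => η k * (p (y k) - pmin)) :
    Summable fun k => η k * (|(y k - xs).2| * d k) := by
  have he0 : ∀ k, 0 ≤ e k := fun k => (mul_nonneg (abs_nonneg _) (hd0 k)).trans (hde k)
  by_cases h0 : xs.2 = 0
  · refine he.of_nonneg_of_le (fun k => mul_nonneg (hη k) (mul_nonneg (abs_nonneg _) (hd0 k)))
      fun k => mul_le_mul_of_nonneg_left ?_ (hη k)
    rw [Prod.snd_sub, h0, sub_zero]
    exact hde k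
  · have hcont : ContinuousOn (fun x => p x - pmin + |x.2|)
        {x : Vec m × ℝ | x ∈ feasible m ∧ |x.2| ≤ 1} :=
      ((hp.mono fun x hx => hx.1).sub continuousOn_const).add (by fun_prop)
    obtain ⟨a, ha, hamin⟩ := (isCompact_feasible_slab (m := m) 1).exists_isMinOn
      ⟨((y 0).1, 0), hy 0, by simp⟩ hcont
    set c := p a - pmin + |a.2| with hc
    have hcpos : 0 < c := by
      have h1 := hmin a ha.1
      have h2 := abs_nonneg a.2
      by_contra hcon
      exact h0 (hxs a ha.1 (by linarith) (abs_eq_zero.1 (by linarith)))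
    have hdk : ∀ k, d k ≤ c⁻¹ * ((p (y k) - pmin) + e k) + e k := by
      intro k
      have hg : 0 ≤ p (y k) - pmin := sub_nonneg.2 (hmin _ (hy k))
      rcases le_total |(y k).2| 1 with h | h
      · have h1 : c ≤ p (y k) - pmin + |(y k).2| := hamin ⟨hy k, h⟩
        have h2 : d k ≤ c⁻¹ * ((p (y k) - pmin) + e k) := by
          rw [inv_mul_eq_div, le_div_iff₀ hcpos]
          nlinarith [mul_le_mul_of_nonneg_left h1 (hd0 k), hde k,
            mul_le_mul_of_nonneg_right (hd1 k) hg]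
        linarith [he0 k]
      · have h1 : 0 ≤ c⁻¹ * ((p (y k) - pmin) + e k) :=
          mul_nonneg (inv_nonneg.2 hcpos.le) (add_nonneg hg (he0 k))
        nlinarith [hde k, hd0 k]
    have hB0 : 0 ≤ B := (abs_nonneg _).trans (hB 0)
    refine ((((hgap.add he).mul_left c⁻¹).add he).mul_left B).of_nonneg_of_le
      (fun k => mul_nonneg (hη k) (mul_nonneg (abs_nonneg _) (hd0 k))) fun k => ?_
    have h1 : |(y k - xs).2| * d k ≤ B * (c⁻¹ * ((p (y k) - pmin) + e k) + e k) :=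
      mul_le_mul (hB k) (hdk k) (hd0 k) hB0
    calc _ ≤ η k * (B * (c⁻¹ * ((p (y k) - pmin) + e k) + e k)) :=
          mul_le_mul_of_nonneg_left h1 (hη k)
      _ = _ := by ring

end

end BiasedSMD

theorem theorem2 {Ω : Type*} [MeasurableSpace Ω] (P : Measure Ω) [IsProbabilityMeasure P]
    (m : ℕ) (α lam : ℝ) (hα : α ∈ Set.Ioo (0 : ℝ) 1) (hlam : 0 < lam)
    -- the returns
    (Z : Ω → BiasedSMD.Vec m) (hZ : Measurable Z) (hZ2 : MemLp Z 2 P)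
    (hZac : P.map Z ≪ volume)
    -- the independent, biased simulations
    (Zhat : ℕ → Ω → BiasedSMD.Vec m) (hZhat : ∀ k, Measurable (Zhat k))
    (hindep : iIndepFun (fun k => Zhat (k + 1)) P)
    (δ υ : ℕ → ℝ)
    (hbias1 : ∀ k, BiasedSMD.wasserstein1 (P.map (Zhat (k + 1))) (P.map Z)
      ≤ ENNReal.ofReal (δ (k + 1)))
    (hbias2 : ∀ k, ∀ u ∈ BiasedSMD.simplex m, ∀ θ : ℝ,
      |(∫ ω, inner ℝ (Z ω) u * BiasedSMD.ind (u, θ) (Z ω) ∂P)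
        - ∫ ω, inner ℝ (Zhat (k + 1) ω) u * BiasedSMD.ind (u, θ) (Zhat (k + 1) ω) ∂P| ≤ υ (k + 1))
    -- the step sizes
    (η : ℕ → ℝ) (hη : ∀ k, 0 < η k)
    (hη1 : Tendsto (fun n => ∑ k ∈ Finset.range n, η (k + 1)) atTop atTop)
    (hη2 : Summable fun k => η (k + 1) ^ 2)
    (hηbias : Summable fun k => η (k + 1) * (√(δ (k + 1)) + υ (k + 1)))
    -- the initial point, with positive weights
    (x₀ : BiasedSMD.Vec m × ℝ) (hx₀ : x₀ ∈ BiasedSMD.feasible m) (hx₀pos : ∀ i, 0 < x₀.1 i)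
    -- the iterates
    (X : ℕ → Ω → BiasedSMD.Vec m × ℝ)
    (hX : ∀ k ω, X k ω = BiasedSMD.smd α lam η x₀ (fun j => Zhat j ω) k) :
    -- the minimum is attained, and the criterion is differentiable on the constraint set
    (∃ xs, BiasedSMD.IsMinimizer P Z α lam xs) ∧
    (∀ x ∈ BiasedSMD.feasible m, DifferentiableAt ℝ (BiasedSMD.pLam P Z α lam) x) ∧
    -- (i)
    (∀ᵐ ω ∂P, Summable fun k =>
      η (k + 1) * (BiasedSMD.pLam P Z α lam (X k ω) - BiasedSMD.minP P Z α lam)) ∧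
    (∀ xs, BiasedSMD.IsMinimizer P Z α lam xs → ∀ ω k,
      0 ≤ BiasedSMD.pLam P Z α lam (X k ω) - BiasedSMD.minP P Z α lam ∧
      BiasedSMD.pLam P Z α lam (X k ω) - BiasedSMD.minP P Z α lam
        ≤ fderiv ℝ (BiasedSMD.pLam P Z α lam) (X k ω) (X k ω - xs)) ∧
    ((∀ k, ∀ u ∈ BiasedSMD.simplex m, ∀ θ : ℝ,
        ‖(∫ ω, BiasedSMD.ind (u, θ) (Z ω) • Z ω ∂P)
          - ∫ ω, BiasedSMD.ind (u, θ) (Zhat (k + 1) ω) • Zhat (k + 1) ω ∂P‖ ≤ υ (k + 1)) →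
      ∀ xs, BiasedSMD.IsMinimizer P Z α lam xs →
        -- in particular, the second alternative holds when `xs` is the only minimizer
        ((∃ C : ℝ≥0, ∀ u ∈ BiasedSMD.simplex m,
            P.map (fun ω => inner ℝ (Z ω) u) ≤ C • (volume : Measure ℝ)) ∨
          (∀ x, BiasedSMD.IsMinimizer P Z α lam x → x.2 = 0 → xs.2 = 0)) →
        ∀ᵐ ω ∂P,
          (Summable fun k =>
            η (k + 1) * fderiv ℝ (BiasedSMD.pLam P Z α lam) (X k ω) (X k ω - xs)) ∧
          ∑' k, η (k + 1) * (BiasedSMD.pLam P Z α lam (X k ω) - BiasedSMD.minP P Z α lam)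
            ≤ ∑' k, η (k + 1) *
                fderiv ℝ (BiasedSMD.pLam P Z α lam) (X k ω) (X k ω - xs)) ∧
    -- (ii)
    (∀ᵐ ω ∂P,
      (∃ x, Tendsto (fun k => BiasedSMD.cesaro η (fun i => X i ω) k) atTop (𝓝 x)) ∧
      Tendsto (fun k => BiasedSMD.pLam P Z α lam (BiasedSMD.cesaro η (fun i => X i ω) k))
        atTop (𝓝 (BiasedSMD.minP P Z α lam))) ∧
    -- (iii)
    ((Summable fun k => √(δ (k + 1)) + υ (k + 1)) →
      ∀ᵐ ω ∂P,
        (∃ x, BiasedSMD.IsMinimizer P Z α lam x ∧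
          Tendsto (fun k => X k ω) atTop (𝓝 x)) ∧
        Tendsto (fun k => BiasedSMD.pLam P Z α lam (X k ω))
          atTop (𝓝 (BiasedSMD.minP P Z α lam))) := by
  have hx₀i : x₀ ∈ BiasedSMD.interiorFeasible m := ⟨hx₀, hx₀pos⟩
  set μ := P.map Z with hμdef
  have hprob : ∀ k, IsProbabilityMeasure (P.map (Zhat k)) := fun k =>
    Measure.isProbabilityMeasure_map (hZhat k).aemeasurable
  have hprobμ : IsProbabilityMeasure μ := Measure.isProbabilityMeasure_map hZ.aemeasurable
  have hμ1 : Integrable (fun z => ‖z‖) μ :=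
    (integrable_map_measure (by fun_prop) hZ.aemeasurable).2 (hZ2.integrable one_le_two).norm
  have hμ2 : Integrable (fun z => ‖z‖ ^ 2) μ :=
    (integrable_map_measure (by fun_prop) hZ.aemeasurable).2 hZ2.norm.integrable_sq
  have hWtop : ∀ k, BiasedSMD.wasserstein1 (P.map (Zhat (k + 1))) μ ≠ ⊤ := fun k =>
    ne_top_of_le_ne_top ENNReal.ofReal_ne_top (hbias1 k)
  have hint : ∀ k, Integrable (fun z => ‖z‖) (P.map (Zhat (k + 1))) := fun k =>
    BiasedSMD.integrable_norm_of_wasserstein1 (hWtop k) hμ1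
  -- real-valued Wasserstein distances of the samples to `Z`
  set w : ℕ → ℝ := fun k => (BiasedSMD.wasserstein1 (P.map (Zhat (k + 1))) μ).toReal with hw
  have hw0 : ∀ k, 0 ≤ w k := fun k => ENNReal.toReal_nonneg
  have hmapb : ∀ (u : BiasedSMD.Vec m) (θ : ℝ) (ζ : Ω → BiasedSMD.Vec m), Measurable ζ →
      ∫ z, inner ℝ z u * BiasedSMD.ind (u, θ) z ∂(P.map ζ) =
        ∫ ω, inner ℝ (ζ ω) u * BiasedSMD.ind (u, θ) (ζ ω) ∂P := by
    intro u θ ζ hζ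
    have := BiasedSMD.measurable_ind_left (u, θ)
    exact integral_map hζ.aemeasurable (by fun_prop)
  have hb2 : ∀ k, ∀ u ∈ BiasedSMD.simplex m, ∀ θ : ℝ,
      |∫ z, inner ℝ z u * BiasedSMD.ind (u, θ) z ∂μ -
        ∫ z, inner ℝ z u * BiasedSMD.ind (u, θ) z ∂(P.map (Zhat (k + 1)))| ≤ υ (k + 1) := by
    intro k u hu θ
    rw [hmapb u θ Z hZ, hmapb u θ _ (hZhat (k + 1))]
    exact hbias2 k u hu θ
  have hυ0 : ∀ k, 0 ≤ υ (k + 1) := fun k => (abs_nonneg _).trans (hbias2 k x₀.1 hx₀ 0)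
  have hηw : Summable fun k => η (k + 1) * w k := by
    refine (hηbias.mul_left (1 + (m + 1) * ∫ z, ‖z‖ ∂μ + 3 * m)).of_nonneg_of_le
      (fun k => mul_nonneg (hη _).le (hw0 k)) fun k => ?_
    rw [mul_left_comm]
    exact mul_le_mul_of_nonneg_left (BiasedSMD.wasserstein1_toReal_le (hint k) hμ1 (hbias1 k)
      (hυ0 k) (hb2 k)) (hη _).le
  have hηυ : Summable fun k => η (k + 1) * υ (k + 1) :=
    hηbias.of_nonneg_of_le (fun k => mul_nonneg (hη _).le (hυ0 k)) fun k =>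
      mul_le_mul_of_nonneg_left (le_add_of_nonneg_left (Real.sqrt_nonneg _)) (hη _).le
  have hηδ : Summable fun k => η (k + 1) * √(δ (k + 1)) :=
    hηbias.of_nonneg_of_le (fun k => mul_nonneg (hη _).le (Real.sqrt_nonneg _)) fun k =>
      mul_le_mul_of_nonneg_left (le_add_of_nonneg_right (hυ0 k)) (hη _).le
  set L := BiasedSMD.gradBound α lam with hL
  have hLpos : 0 < L := BiasedSMD.gradBound_pos hα hlam
  have htr : Summable fun k =>
      ∫ z, BiasedSMD.truncSq (η (k + 1) * L * ‖z‖) ∂(P.map (Zhat (k + 1))) := by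
    refine ((hη2.mul_left (4 * L ^ 2 * ∫ z, ‖z‖ ^ 2 ∂μ)).add
      (hηw.mul_left (2 * L))).of_nonneg_of_le (fun k => integral_nonneg fun z =>
        BiasedSMD.truncSq_nonneg (mul_nonneg (mul_nonneg (hη _).le hLpos.le) (norm_nonneg _)))
      fun k => ?_
    have := (BiasedSMD.integral_truncSq_le (hWtop k) hμ1 hμ2 (c := η (k + 1) * L)
      (mul_nonneg (hη _).le hLpos.le)).2
    refine this.trans_eq ?_
    simp only [hw]; ring
  set p := BiasedSMD.pLam P Z α lam with hp
  have hpc : ∀ x, p x = ∫ z, BiasedSMD.crit α lam x z ∂μ :=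
    BiasedSMD.pLam_eq_integral_crit hZ hμ1
  have hderiv : ∀ x ∈ BiasedSMD.feasible m,
      HasFDerivAt p (∫ z, BiasedSMD.gradForm α lam x z ∂μ) x := by
    intro x hx
    have := (BiasedSMD.hasFDerivAt_integral_crit hα hlam hμ1 hZac hx).2
    rwa [show (fun y => ∫ z, BiasedSMD.crit α lam y z ∂μ) = p from funext fun y => (hpc y).symm]
      at this
  have hfd : ∀ x ∈ BiasedSMD.feasible m, ∀ v,
      fderiv ℝ p x v = BiasedSMD.meanGrad μ α lam x v := by
    intro x hx v
    rw [(hderiv x hx).fderiv, ContinuousLinearMap.integral_apply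
      (BiasedSMD.hasFDerivAt_integral_crit hα hlam hμ1 hZac hx).1]
    rfl
  have hex : ∃ xs, BiasedSMD.IsMinimizer P Z α lam xs := by
    obtain ⟨xs, h1, h2⟩ := BiasedSMD.exists_isMinOn_integral_crit hα hlam hμ1 hZac ⟨x₀, hx₀⟩
    refine ⟨xs, h1, fun x hx => ?_⟩
    show p xs ≤ p x
    rw [hpc, hpc]
    exact h2 hx
  set pmin := BiasedSMD.minP P Z α lam with hpmin
  have hminP : ∀ xs, BiasedSMD.IsMinimizer P Z α lam xs → p xs = pmin := by
    intro xs hxs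
    have hleast : IsLeast (p '' BiasedSMD.feasible m) (p xs) :=
      ⟨⟨xs, hxs.1, rfl⟩, by rintro _ ⟨x, hx, rfl⟩; exact hxs.2 hx⟩
    exact hleast.csInf_eq.symm
  have hmin : ∀ x ∈ BiasedSMD.feasible m, pmin ≤ p x := by
    obtain ⟨xs, hxs⟩ := hex
    intro x hx
    rw [← hminP xs hxs]
    exact hxs.2 hx
  have hminiff : ∀ x ∈ BiasedSMD.feasible m, p x = pmin → BiasedSMD.IsMinimizer P Z α lam x := by
    intro x hx he
    refine ⟨hx, fun y hy => ?_⟩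
    show p x ≤ p y
    rw [he]
    exact hmin y hy
  have hX0 : ∀ ω, X 0 ω = x₀ := fun ω => by rw [hX]; rfl
  have hXs : ∀ k ω, X (k + 1) ω =
      BiasedSMD.step α lam (η (k + 1)) (Zhat (k + 1) ω) (X k ω) := fun k ω => by
    rw [hX, hX]; rfl
  have hXi : ∀ k ω, X k ω ∈ BiasedSMD.interiorFeasible m := by
    intro k ω
    induction k with
    | zero => rw [hX0]; exact hx₀i
    | succ k ih => rw [hXs]; exact BiasedSMD.step_mem_interiorFeasible ih _ _
  have hgapμ : ∀ xs, BiasedSMD.IsMinimizer P Z α lam xs → ∀ x,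
      p x - pmin ≤ BiasedSMD.meanGrad μ α lam x (x - xs) := by
    intro xs hxs x
    rw [← hminP xs hxs, hpc, hpc]
    exact BiasedSMD.integral_crit_sub_le_meanGrad hα hlam hμ1 x xs
  have hgap : ∀ xs, BiasedSMD.IsMinimizer P Z α lam xs → ∀ k, ∀ x ∈ BiasedSMD.feasible m,
      p x - pmin ≤ BiasedSMD.meanGrad (P.map (Zhat (k + 1))) α lam x (x - xs) +
        2 * L * w k := by
    intro xs hxs k x hx
    have hclose : ∀ y ∈ BiasedSMD.feasible m,
        |∫ z, BiasedSMD.crit α lam y z ∂(P.map (Zhat (k + 1))) -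
          ∫ z, BiasedSMD.crit α lam y z ∂μ| ≤ L * w k := fun y hy =>
      BiasedSMD.abs_integral_sub_le_wasserstein1 (hWtop k) hLpos.le (BiasedSMD.measurable_crit y)
        (BiasedSMD.integrable_crit (hint k) y) (BiasedSMD.integrable_crit hμ1 y)
        (BiasedSMD.abs_crit_sub_le_sample hα hlam hy)
    have h1 := BiasedSMD.integral_crit_sub_le_meanGrad hα hlam (hint k) x xs
    have h2 := (abs_le.1 (hclose x hx)).1
    have h3 := (abs_le.1 (hclose xs hxs.1)).2
    rw [← hminP xs hxs, hpc, hpc]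
    linarith
  have hV : ∀ xs, BiasedSMD.IsMinimizer P Z α lam xs → ∀ᵐ ω ∂P,
      (∃ l, Tendsto (fun k => BiasedSMD.bregman xs (X k ω)) atTop (𝓝 l)) ∧
      Summable fun k => η (k + 1) *
        BiasedSMD.meanGrad (P.map (Zhat (k + 1))) α lam (X k ω) (X k ω - xs) := by
    intro xs hxs
    refine BiasedSMD.ae_bregman_tendsto hα hlam hZhat hindep hint hη hη2 htr hx₀i hX0 hXs hxs.1
      (c := fun k => 2 * L * w k) (fun k => mul_nonneg (by positivity) (hw0 k)) ?_ fun k x hx => ?_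
    · exact (hηw.mul_left (2 * L)).congr fun k => by ring
    · have h1 := hgap xs hxs k x hx.1
      have h2 := hmin x hx.1
      linarith
  have hsum : ∀ᵐ ω ∂P, Summable fun k => η (k + 1) * (p (X k ω) - pmin) := by
    obtain ⟨xs, hxs⟩ := hex
    filter_upwards [hV xs hxs] with ω hω
    refine (hω.2.add (hηw.mul_left (2 * L))).of_nonneg_of_le
      (fun k => mul_nonneg (hη _).le (sub_nonneg.2 (hmin _ (hXi k ω).1))) fun k => ?_
    have := mul_le_mul_of_nonneg_left (hgap xs hxs k _ (hXi k ω).1) (hη (k + 1)).le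
    linarith
  have hconv : ∀ᵐ ω ∂P, ∃ x, BiasedSMD.IsMinimizer P Z α lam x ∧
      Tendsto (fun k => X k ω) atTop (𝓝 x) := by
    -- finitely many minimizers suffice, so that the exceptional events form a null set
    obtain ⟨b, hbS, hbfin, hb⟩ :=
      BiasedSMD.exists_finite_bregman_tendsto {x | BiasedSMD.IsMinimizer P Z α lam x}
    have hae : ∀ᵐ ω ∂P, ∀ x ∈ b,
        ∃ l, Tendsto (fun k => BiasedSMD.bregman x (X k ω)) atTop (𝓝 l) :=
      (ae_ball_iff hbfin.countable).2 fun x hx => (hV x (hbS hx)).mono fun ω hω => hω.1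
    filter_upwards [hae, hsum] with ω h1 h2
    obtain ⟨xs, hxs⟩ := hex
    obtain ⟨x, hx, hpx, hlim⟩ := BiasedSMD.exists_tendsto_minimizer
      (fun x hx => (hderiv x hx).continuousAt) hmin ⟨xs, hxs.1, hminP xs hxs⟩ hη hη1
      (fun k => hXi k ω) h2 fun x hx hpx => hb _ h1 x (hminiff x hx hpx)
    exact ⟨x, hminiff x hx hpx, hlim⟩
  have hplim : ∀ {y : ℕ → BiasedSMD.Vec m × ℝ} {x}, BiasedSMD.IsMinimizer P Z α lam x →
      Tendsto y atTop (𝓝 x) → Tendsto (fun k => p (y k)) atTop (𝓝 pmin) := by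
    intro y x hx hy
    rw [← hminP x hx]
    exact (hderiv x hx.1).continuousAt.tendsto.comp hy
  refine ⟨hex, fun x hx => (hderiv x hx).differentiableAt, hsum, ?_, ?_, ?_, ?_⟩
  · intro xs hxs ω k
    refine ⟨sub_nonneg.2 (hmin _ (hXi k ω).1), ?_⟩
    rw [hfd _ (hXi k ω).1]
    exact hgapμ xs hxs _
  · intro hvec xs hxs halt
    filter_upwards [hV xs hxs, hsum, hconv] with ω hVω hsω hcω
    obtain ⟨B, hB⟩ : ∃ B, ∀ k, |(X k ω - xs).2| ≤ B := by
      obtain ⟨x, -, hx⟩ := hcω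
      have h1 : Tendsto (fun k => |(X k ω - xs).2|) atTop (𝓝 |(x - xs).2|) :=
        ((continuous_snd.tendsto _).comp (hx.sub_const xs)).abs
      obtain ⟨B, hB⟩ := h1.bddAbove_range
      exact ⟨B, fun k => hB ⟨k, rfl⟩⟩
    -- the error on the probability of the half-space `⟨z, U_k⟩ ≥ θ_k`
    set d : ℕ → ℝ := fun k => |∫ z, BiasedSMD.ind (X k ω) z ∂(P.map (Zhat (k + 1))) -
      ∫ z, BiasedSMD.ind (X k ω) z ∂μ| with hd
    have hd0 : ∀ k, 0 ≤ d k := fun k => abs_nonneg _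
    have hd1 : ∀ k, d k ≤ 1 := by
      have h01 : ∀ (π : Measure (BiasedSMD.Vec m)) (x : BiasedSMD.Vec m × ℝ),
          IsProbabilityMeasure π → 0 ≤ ∫ z, BiasedSMD.ind x z ∂π ∧
            ∫ z, BiasedSMD.ind x z ∂π ≤ 1 := by
        intro π x _
        refine ⟨integral_nonneg (BiasedSMD.ind_nonneg x), ?_⟩
        have := integral_mono (BiasedSMD.integrable_ind (μ := π) x) (integrable_const (1 : ℝ))
          (BiasedSMD.ind_le_one x)
        simpa using this
      intro k
      have h1 := h01 (P.map (Zhat (k + 1))) (X k ω) (hprob _)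
      have h2 := h01 μ (X k ω) hprobμ
      exact abs_le.2 ⟨by linarith, by linarith⟩
    have hηwυ : Summable fun k => η (k + 1) * (w k + υ (k + 1)) :=
      (hηw.add hηυ).congr fun k => by ring
    have hdsum : Summable fun k => η (k + 1) * (|(X k ω - xs).2| * d k) := by
      rcases halt with ⟨C, hC⟩ | hzero
      · refine (hηδ.mul_left (B * (2 * C + 1))).of_nonneg_of_le
          (fun k => mul_nonneg (hη _).le (mul_nonneg (abs_nonneg _) (hd0 k))) fun k => ?_
        have hCk : μ.map (fun z => inner ℝ z (X k ω).1) ≤ C • (volume : Measure ℝ) := by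
          rw [hμdef, Measure.map_map (by fun_prop) hZ]
          exact hC _ (hXi k ω).1
        have h1 : |(X k ω - xs).2| * d k ≤ B * ((2 * C + 1) * √(δ (k + 1))) :=
          mul_le_mul (hB k) (BiasedSMD.abs_integral_ind_sub_le_sqrt (hbias1 k) (hXi k ω).1 hCk)
            (hd0 k) ((abs_nonneg _).trans (hB 0))
        calc _ ≤ η (k + 1) * (B * ((2 * C + 1) * √(δ (k + 1)))) :=
              mul_le_mul_of_nonneg_left h1 (hη _).le
          _ = _ := by ring
      · exact BiasedSMD.summable_threshold_mul (p := p) (pmin := pmin) (xs := xs)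
          (η := fun k => η (k + 1)) (e := fun k => w k + υ (k + 1))
          (fun x hx => (hderiv x hx).continuousAt.continuousWithinAt) hmin
          (fun x hx hpx => hzero x (hminiff x hx hpx)) (fun k => (hXi k ω).1) hB
          (fun k => (hη _).le) hd0 hd1
          (fun k => BiasedSMD.abs_mul_abs_integral_ind_sub_le (hint k) hμ1 (hWtop k) (hXi k ω).1
            (hb2 k _ (hXi k ω).1 _)) hηwυ hsω
    have hmapv : ∀ (x : BiasedSMD.Vec m × ℝ) (ζ : Ω → BiasedSMD.Vec m), Measurable ζ →
        ∫ z, BiasedSMD.ind x z • z ∂(P.map ζ) = ∫ ω, BiasedSMD.ind x (ζ ω) • ζ ω ∂P := by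
      intro x ζ hζ
      have := BiasedSMD.measurable_ind_left x
      exact integral_map hζ.aemeasurable (by fun_prop)
    have hdiff : ∀ k, |BiasedSMD.meanGrad (P.map (Zhat (k + 1))) α lam (X k ω) (X k ω - xs) -
        BiasedSMD.meanGrad μ α lam (X k ω) (X k ω - xs)| ≤
          L * (2 * (w k + υ (k + 1)) + |(X k ω - xs).2| * d k) := by
      intro k
      have hbk : ‖∫ z, BiasedSMD.ind (X k ω) z • z ∂μ -
          ∫ z, BiasedSMD.ind (X k ω) z • z ∂(P.map (Zhat (k + 1)))‖ ≤ υ (k + 1) := by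
        rw [hmapv _ Z hZ, hmapv _ _ (hZhat (k + 1))]
        exact hvec k _ (hXi k ω).1 _
      refine (BiasedSMD.abs_meanGrad_sub_le (hint k) hμ1 hα hlam (hWtop k) hbk _).trans ?_
      have h2 : ‖(X k ω - xs).1‖ ≤ 2 := by
        rw [Prod.fst_sub]
        have h3 := BiasedSMD.norm_fst_le_one (hXi k ω).1
        have h4 := BiasedSMD.norm_fst_le_one hxs.1
        linarith [norm_sub_le (X k ω).1 xs.1]
      have h5 : 0 ≤ w k + υ (k + 1) := add_nonneg (hw0 k) (hυ0 k)
      gcongr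
    have hsummable : Summable fun k => η (k + 1) *
        BiasedSMD.meanGrad μ α lam (X k ω) (X k ω - xs) := by
      have h1 : Summable fun k => η (k + 1) *
          (BiasedSMD.meanGrad (P.map (Zhat (k + 1))) α lam (X k ω) (X k ω - xs) -
            BiasedSMD.meanGrad μ α lam (X k ω) (X k ω - xs)) := by
        refine Summable.of_norm_bounded (((hηwυ.mul_left 2).add hdsum).mul_left L) fun k => ?_
        rw [norm_mul, Real.norm_of_nonneg (hη _).le, Real.norm_eq_abs]
        refine (mul_le_mul_of_nonneg_left (hdiff k) (hη _).le).trans_eq ?_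
        ring
      exact (hVω.2.sub h1).congr fun k => by ring
    simp_rw [fun k => hfd _ (hXi k ω).1]
    exact ⟨hsummable, hsω.tsum_le_tsum (fun k => mul_le_mul_of_nonneg_left
      (hgapμ xs hxs _) (hη _).le) hsummable⟩
  · filter_upwards [hconv] with ω hω
    obtain ⟨x, hx, hlim⟩ := hω
    have h := BiasedSMD.tendsto_cesaro hη hη1 hlim
    exact ⟨⟨x, h⟩, hplim hx h⟩
  · intro _
    filter_upwards [hconv] with ω hω
    obtain ⟨x, hx, hlim⟩ := hω
    exact ⟨⟨x, hx, hlim⟩, hplim hx hlim⟩
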